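/- Let $r\ge 2$ be an integer. For an integer $N\ge 4r$ put $h=1/N$, $x_i=ih$, and let $$\mathcal S_h^r=\{v\in C^{r-2}(\mathbb R):\ v \text{ real-valued and 1-periodic},\ v|_{(x_{i-1},x_i)}\text{ is a polynomial of degree at most } r-1,\ i=1,\dots,N\}.$$ Let $P_h$ be the $L^2(0,1)$-projection onto $\mathcal S_h^r$, i.e. $P_hu\in\mathcal S_h^r$ and $\int_0^1 (P_hu)\chi\,dx=\int_0^1 u\chi\,dx$ for all $\chi\in\mathcal S_h^r$. Let $H^l_{per}$ (respectively $W^l_\infty$) denote the space of real-valued 1-periodic functions on $\mathbb R$ all of whose weak derivatives of order at most $l$ exist and belong to $L^2(0,1)$ (respectively $L^\infty(0,1)$), let $\partial_x^l$ be the weak derivative of order $l$, and let $\|\cdot\|$, $\|\cdot\|_\infty$ be the norms of $L^2(0,1)$, $L^\infty(0,1)$. Proposition 5.1. For each $l=0,1,\dots,r-1$ there exist constants $C_1,C_2$, depending only on $l$ and $r$ (in particular not on $N$ or $u$), such that for all $N\ge 4r$: (i) if $u\in H^l_{per}$, then $P_hu\in H^l_{per}$ and $\|\partial_x^l(P_hu)\|\le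 C_1\|\partial_x^l u\|$; (ii) if $u\in W^l_\infty\cap H^l_{per}$, then $P_hu\in W^l_\infty$ and $\|\partial_x^l(P_hu)\|_\infty\le C_2\|\partial_x^l u\|_\infty$. -/

import Mathlib

open MeasureTheory

/-- `g` is the weak derivative of order `k` of `u` on the real line: both functions are locally
integrable and `∫ u φ⁽ᵏ⁾ = (-1)ᵏ ∫ g φ` for every compactly supported smooth `φ : ℝ → ℝ`. -/
def HasWeakDeriv (k : ℕ) (u g : ℝ → ℝ) : Prop :=
  LocallyIntegrable u volume ∧ LocallyIntegrable g volume ∧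
    ∀ φ : ℝ → ℝ, ContDiff ℝ (⊤ : ℕ∞) φ → HasCompactSupport φ →
      ∫ x, u x * iteratedDeriv k φ x = (-1) ^ k * ∫ x, g x * φ x

/-- Lebesgue measure on one period `[0,1]`. -/
noncomputable abbrev periodMeasure : Measure ℝ := volume.restrict (Set.Icc (0 : ℝ) 1)

/-- The Sobolev space `W^{l,p}` of `1`-periodic functions: all weak derivatives of order at most
`l` exist and belong to `L^p` over one period (for the order `0` this says that `u` itself does).
For `p = 2` this is `H^l_per`, for `p = ∞` it is the space `W^l_∞` of periodic functions. -/
def MemSobolevPer (p : ENNReal) (l : ℕ) (u : ℝ → ℝ) : Prop :=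
  Function.Periodic u 1 ∧
    ∀ k ≤ l, ∃ g : ℝ → ℝ, Function.Periodic g 1 ∧ HasWeakDeriv k u g ∧ MemLp g p periodMeasure

/-- The space of smooth `1`-periodic splines of order `r ≥ 2` on the uniform mesh with `N`
subintervals of length `h = 1 / N`: the functions of class `C^{r-2}` and period `1` which on each
interval `(i / N, (i + 1) / N)` coincide with a polynomial of degree at most `r - 1`. -/
def splineSpace (r N : ℕ) : Submodule ℝ (ℝ → ℝ) where
  carrier := {v | Function.Periodic v 1 ∧ ContDiff ℝ ((r - 2 : ℕ) : ℕ∞) v ∧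
    ∀ i < N, ∃ q : Polynomial ℝ, q.natDegree ≤ r - 1 ∧
      ∀ x ∈ Set.Ioo ((i : ℝ) / N) (((i : ℝ) + 1) / N), v x = q.eval x}
  add_mem' := by
    rintro v w ⟨hv, hv', hv''⟩ ⟨hw, hw', hw''⟩
    refine ⟨hv.add hw, hv'.add hw', fun i hi => ?_⟩
    obtain ⟨p, hp, hp'⟩ := hv'' i hi
    obtain ⟨q, hq, hq'⟩ := hw'' i hi
    exact ⟨p + q, Polynomial.natDegree_add_le_of_degree_le hp hq, fun x hx => by
      simp [hp' x hx, hq' x hx]⟩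
  zero_mem' := ⟨fun _ => rfl, contDiff_const, fun _ _ => ⟨0, by simp, fun _ _ => by simp⟩⟩
  smul_mem' := by
    rintro c v ⟨hv, hv', hv''⟩
    refine ⟨fun x => by simp [hv x], contDiff_const.smul hv', fun i hi => ?_⟩
    obtain ⟨p, hp, hp'⟩ := hv'' i hi
    exact ⟨c • p, (Polynomial.natDegree_smul_le c p).trans hp, fun x hx => by simp [hp' x hx]⟩

/-- `v` is the `L²(0,1)`-projection of `u` onto the spline space: `v` is a spline and
`(v, χ) = (u, χ)` for every spline `χ`, with `(f, g) = ∫₀¹ f g`. -/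
def IsL2Proj (r N : ℕ) (u v : ℝ → ℝ) : Prop :=
  v ∈ splineSpace r N ∧ ∀ χ ∈ splineSpace r N,
    ∫ x in (0 : ℝ)..1, v x * χ x = ∫ x in (0 : ℝ)..1, u x * χ x

open Classical in
/-- The `L²`-projection operator `P_h`, `h = 1 / N`, onto the spline space. The projection of `u`
exists and is unique for every `u` integrable over `(0,1)`, in particular for every `u ∈ L²`, by
`isL2Proj_l2Proj` and `IsL2Proj.eq` below; the value `0` otherwise is irrelevant. -/
noncomputable def l2Proj (r N : ℕ) (u : ℝ → ℝ) : ℝ → ℝ :=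
  if h : ∃ v, IsL2Proj r N u v then h.choose else 0

theorem splineSpace_continuous {r N : ℕ} {v : ℝ → ℝ} (hv : v ∈ splineSpace r N) :
    Continuous v := hv.2.1.continuous

theorem splineSpace_eq_zero {r N : ℕ} {v : ℝ → ℝ} (hv : v ∈ splineSpace r N)
    (h0 : ∀ x ∈ Set.Ico (0 : ℝ) 1, v x = 0) : v = 0 := by
  funext x
  have h1 : v (Int.fract x) = v x := by
    have := hv.1.sub_zsmul_eq (x := x) ⌊x⌋
    rwa [zsmul_one] at this
  rw [← h1]
  exact h0 _ ⟨Int.fract_nonneg x, Int.fract_lt_one x⟩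

theorem splineSpace_finiteDimensional (r N : ℕ) [NeZero r] [NeZero N] :
    FiniteDimensional ℝ (splineSpace r N) := by
  have hN : (0 : ℝ) < N := by exact_mod_cast Nat.pos_of_ne_zero (NeZero.ne N)
  let T : splineSpace r N →ₗ[ℝ] (Fin N × Fin r → ℝ) :=
    { toFun := fun v a => v.1 (((a.1 : ℝ) + ((a.2 : ℝ) + 1) / ((r : ℝ) + 1)) / N)
      map_add' := fun _ _ => rfl
      map_smul' := fun _ _ => rfl }
  refine FiniteDimensional.of_injective T ?_
  rw [← LinearMap.ker_eq_bot, LinearMap.ker_eq_bot']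
  rintro ⟨v, hv⟩ hT
  apply Subtype.ext
  refine splineSpace_eq_zero hv fun x hx => ?_
  set i := ⌊(N : ℝ) * x⌋₊ with hi
  have hNx : 0 ≤ (N : ℝ) * x := mul_nonneg hN.le hx.1
  have hi1 : (i : ℝ) ≤ N * x := Nat.floor_le hNx
  have hi2 : (N : ℝ) * x < i + 1 := Nat.lt_floor_add_one _
  have hiN : i < N := by
    rw [hi, Nat.floor_lt hNx]
    nlinarith [hx.2]
  obtain ⟨q, hq, hqv⟩ := hv.2.2 i hiN
  have hq0 : q = 0 := by
    refine Polynomial.eq_zero_of_natDegree_lt_card_of_eval_eq_zero q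
      (ι := Fin r) (f := fun j => ((i : ℝ) + ((j : ℝ) + 1) / ((r : ℝ) + 1)) / N) ?_ ?_ ?_
    · intro a b hab
      have hr : (r : ℝ) + 1 ≠ 0 := by positivity
      field_simp at hab
      apply Fin.ext
      have : (a : ℝ) = b := by linarith
      exact_mod_cast this
    · intro j
      rw [← hqv]
      · exact congrFun hT (⟨i, hiN⟩, j)
      · have hr : (0 : ℝ) < (r : ℝ) + 1 := by positivity
        have h1 : (0 : ℝ) < ((j : ℝ) + 1) / ((r : ℝ) + 1) := by positivity
        have hj : (j : ℝ) < r := by exact_mod_cast j.2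
        have h2 : ((j : ℝ) + 1) / ((r : ℝ) + 1) < 1 := by
          rw [div_lt_one hr]; linarith
        constructor
        · gcongr; linarith
        · gcongr
    · have := NeZero.pos r
      simp; omega
  have hcl : IsClosed {y | v y = 0} :=
    isClosed_eq (splineSpace_continuous hv) continuous_const
  have hsub : Set.Ioo ((i : ℝ) / N) (((i : ℝ) + 1) / N) ⊆ {y | v y = 0} := fun y hy => by
    simp [hqv y hy, hq0]
  have := closure_minimal hsub hcl
  have hlt : (i : ℝ) / N < ((i : ℝ) + 1) / N := by gcongr; linarith
  rw [closure_Ioo hlt.ne] at this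
  refine this ⟨?_, ?_⟩
  · rw [div_le_iff₀ hN]; linarith
  · rw [le_div_iff₀ hN]; linarith

theorem splineSpace_eq_zero_of_integral {r N : ℕ} {v : ℝ → ℝ} (hv : v ∈ splineSpace r N)
    (h0 : ∫ x in (0 : ℝ)..1, v x * v x = 0) : v = 0 := by
  have hc := splineSpace_continuous hv
  refine splineSpace_eq_zero hv fun x hx => ?_
  by_contra hne
  have := intervalIntegral.integral_pos (f := fun x => v x * v x) zero_lt_one
    (hc.mul hc).continuousOn (fun y _ => mul_self_nonneg _)
    ⟨x, ⟨hx.1, hx.2.le⟩, mul_self_pos.2 hne⟩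
  exact this.ne' h0

/-- The `L²`-projection onto the spline space is unique. -/
theorem IsL2Proj.eq {r N : ℕ} {u v w : ℝ → ℝ} (hv : IsL2Proj r N u v) (hw : IsL2Proj r N u w) :
    v = w := by
  have hmem : v - w ∈ splineSpace r N := Submodule.sub_mem _ hv.1 hw.1
  have hc := splineSpace_continuous hmem
  rw [← sub_eq_zero]
  apply splineSpace_eq_zero_of_integral hmem
  have h := (hv.2 _ hmem).trans (hw.2 _ hmem).symm
  simp only [Pi.sub_apply, sub_mul] at *
  rw [intervalIntegral.integral_sub, h, sub_self]
  · exact ((splineSpace_continuous hv.1).mul hc).intervalIntegrable _ _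
  · exact ((splineSpace_continuous hw.1).mul hc).intervalIntegrable _ _

/-- The `L²`-projection onto the spline space exists for every function integrable on `(0,1)`. -/
theorem exists_isL2Proj {r N : ℕ} (hr : r ≠ 0) (hN : N ≠ 0) {u : ℝ → ℝ}
    (hu : IntervalIntegrable u volume 0 1) : ∃ v, IsL2Proj r N u v := by
  have : NeZero r := ⟨hr⟩
  have : NeZero N := ⟨hN⟩
  have := splineSpace_finiteDimensional r N
  have key : ∀ f : ℝ → ℝ, IntervalIntegrable f volume 0 1 → ∀ χ : splineSpace r N,
      IntervalIntegrable (fun x => f x * χ.1 x) volume 0 1 := fun f hf χ =>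
    hf.mul_continuousOn (splineSpace_continuous χ.2).continuousOn
  let L : (f : ℝ → ℝ) → IntervalIntegrable f volume 0 1 → Module.Dual ℝ (splineSpace r N) :=
    fun f hf =>
    { toFun := fun χ => ∫ x in (0 : ℝ)..1, f x * χ.1 x
      map_add' := fun χ ψ => by
        simp only [Submodule.coe_add, Pi.add_apply, mul_add]
        exact intervalIntegral.integral_add (key f hf χ) (key f hf ψ)
      map_smul' := fun c χ => by
        simp only [Submodule.coe_smul, Pi.smul_apply, smul_eq_mul, RingHom.id_apply,
          mul_left_comm _ c]
        exact intervalIntegral.integral_const_mul _ _ }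
  have hS : ∀ v : splineSpace r N, IntervalIntegrable v.1 volume 0 1 := fun v =>
    (splineSpace_continuous v.2).intervalIntegrable _ _
  let B : splineSpace r N →ₗ[ℝ] Module.Dual ℝ (splineSpace r N) :=
    { toFun := fun v => L v.1 (hS v)
      map_add' := fun v w => by
        ext χ
        change ∫ x in (0 : ℝ)..1, (v.1 x + w.1 x) * χ.1 x = _
        simp only [add_mul]
        exact intervalIntegral.integral_add (key _ (hS v) χ) (key _ (hS w) χ)
      map_smul' := fun c v => by
        ext χ
        change ∫ x in (0 : ℝ)..1, (c * v.1 x) * χ.1 x = c * ∫ x in (0 : ℝ)..1, v.1 x * χ.1 x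
        simp only [mul_assoc]
        exact intervalIntegral.integral_const_mul _ _ }
  have hB : Function.Injective B := by
    rw [← LinearMap.ker_eq_bot, LinearMap.ker_eq_bot']
    intro v hv
    exact Subtype.ext (splineSpace_eq_zero_of_integral v.2 (LinearMap.congr_fun hv v))
  have hB' : Function.Surjective B :=
    (LinearMap.injective_iff_surjective_of_finrank_eq_finrank
      Subspace.dual_finrank_eq.symm).1 hB
  obtain ⟨v, hv⟩ := hB' (L u hu)
  exact ⟨v.1, v.2, fun χ hχ => LinearMap.congr_fun hv ⟨χ, hχ⟩⟩

theorem isL2Proj_l2Proj {r N : ℕ} (hr : r ≠ 0) (hN : N ≠ 0) {u : ℝ → ℝ}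
    (hu : IntervalIntegrable u volume 0 1) : IsL2Proj r N u (l2Proj r N u) := by
  have h := exists_isL2Proj hr hN hu
  rw [l2Proj, dif_pos h]
  exact h.choose_spec

/-! Put h = 1/N and let A be the backward mean `avg h`. A spline of degree n is A^n applied to a
step function (`spl`), whose values are the B-spline coefficients. For N-periodic coefficients and n
= r - 1 these are exactly the elements of the spline space (`spl_mem_splineSpace`, `exists_spl_eq`).
The adjoint A* is the forward mean `avg (-h)`, so pairing a function with a B-spline amounts to
taking r forward means and sampling at a node. The normal equations therefore say that the Gram
matrix G, applied to the coefficients c of the projection, gives the node samples of (A*)^r u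
(`gram_eq_of_isL2Proj`).

Differentiation preserves this structure. The derivative of A f is the difference quotient of f, so
the l-th derivative of the projection is a spline of degree r - 1 - l with coefficients e = h^(-l)
times the l-th differences of c. G is Toeplitz and commutes with differences, and the l-th
difference of u is h^l A^l g with g the l-th weak derivative. Hence e solves the same Gram system
with data sampled from (A*)^r A^l g (`exists_coeff_deriv_l2Proj`). Means are contractions in both
norms, so only bounds for the inverse of G, uniform in N, remain.

In ℓ² the bound is coercivity (`exists_gram_coercive`), a consequence of local linear independence
of B-splines on one cell. For the supremum norm, c ↦ c - κ G c contracts ℓ² by a fixed factor q < 1,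
while n iterations see only O(n) neighbours. The supremum norm of the n-th iterate is thus at most
O(√n) q^n times that of c, which for one fixed n is at most half; the rest of c is controlled by G c
(`exists_abs_le_of_abs_gram_le`). -/

namespace PeriodicSpline

/-! ### Averages, differences and their algebra. -/

/-- The mean value of `f` over the interval between `x - h` and `x`. -/
noncomputable def avg (h : ℝ) (f : ℝ → ℝ) (x : ℝ) : ℝ := ∫ s in (0 : ℝ)..1, f (x - h * s)

/-- The backward difference of `f` with step `h`. -/
def diff (h : ℝ) (f : ℝ → ℝ) (x : ℝ) : ℝ := f x - f (x - h)

theorem avg_eq {h : ℝ} (hh : h ≠ 0) (f : ℝ → ℝ) (x : ℝ) :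
    avg h f x = h⁻¹ * ∫ t in (x - h)..x, f t := by
  rw [avg, intervalIntegral.integral_comp_sub_mul f hh]
  simp

/-- One average turns almost everywhere equality into equality at every point, which is what makes
point samples of averaged data meaningful. -/
theorem avg_congr_ae {h : ℝ} (hh : h ≠ 0) {f g : ℝ → ℝ} (hfg : f =ᵐ[volume] g) :
    avg h f = avg h g := by
  funext x
  rw [avg_eq hh, avg_eq hh]
  congr 1
  apply intervalIntegral.integral_congr_ae
  filter_upwards [hfg] with y hy _ using hy

/-- Substitute s ↦ 1 - s: forward and backward means are translates of each other, so the adjoint of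
`avg h` is again covered by the same theory. -/
theorem avg_neg (h : ℝ) (f : ℝ → ℝ) (x : ℝ) : avg (-h) f x = avg h f (x + h) := by
  have := intervalIntegral.integral_comp_sub_left (a := 0) (b := 1) (fun s => f (x + h - h * s)) 1
  simp only [sub_self, sub_zero] at this
  rw [avg, avg, ← this]
  congr 1
  funext s
  ring_nf

theorem intervalIntegrable_of_locallyIntegrable {f : ℝ → ℝ} (hf : LocallyIntegrable f volume)
    (a b : ℝ) : IntervalIntegrable f volume a b :=
  (hf.integrableOn_isCompact isCompact_uIcc).intervalIntegrable

/-- The integrated form of the rule that the derivative of a mean is a difference quotient. It needs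
only local integrability, so it also applies to step functions. -/
theorem avg_sub_avg {h : ℝ} (hh : h ≠ 0) {f : ℝ → ℝ} (hf : LocallyIntegrable f volume) (x y : ℝ) :
    avg h f x - avg h f y = h⁻¹ * ∫ t in y..x, diff h f t := by
  have hi := intervalIntegrable_of_locallyIntegrable hf
  rw [avg_eq hh, avg_eq hh]
  have h1 : ∫ t in y..x, f (t - h) = ∫ t in (y - h)..(x - h), f t :=
    intervalIntegral.integral_comp_sub_right f h
  have h2 : IntervalIntegrable (fun t => f (t - h)) volume y x := by
    simpa using (hi (y - h) (x - h)).comp_sub_right h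
  simp only [diff]
  rw [intervalIntegral.integral_sub (hi _ _) h2, h1]
  have h3 := intervalIntegral.integral_add_adjacent_intervals (hi (x - h) (y - h)) (hi (y - h) y)
  have h4 := intervalIntegral.integral_add_adjacent_intervals (hi (x - h) y) (hi y x)
  have h5 := intervalIntegral.integral_symm (μ := volume) (f := f) (x - h) (y - h)
  rw [← mul_sub]
  congr 1
  linarith

theorem avg_continuous {h : ℝ} (hh : h ≠ 0) {f : ℝ → ℝ} (hf : LocallyIntegrable f volume) :
    Continuous (avg h f) := by
  have h1 : avg h f = fun x => avg h f 0 + h⁻¹ * ∫ t in (0 : ℝ)..x, diff h f t := by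
    funext x
    rw [← avg_sub_avg hh hf]; ring
  have hd : ∀ a b, IntervalIntegrable (diff h f) volume a b := fun a b =>
    (intervalIntegrable_of_locallyIntegrable hf a b).sub (by
      simpa using
        (intervalIntegrable_of_locallyIntegrable hf (a - h) (b - h)).comp_sub_right h)
  rw [h1]
  exact continuous_const.add
    (continuous_const.mul (intervalIntegral.continuous_primitive hd 0))

theorem locallyIntegrable_iterate_avg {h : ℝ} (hh : h ≠ 0) {f : ℝ → ℝ}
    (hf : LocallyIntegrable f volume) (n : ℕ) : LocallyIntegrable ((avg h)^[n] f) volume := by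
  induction n with
  | zero => exact hf
  | succ n ih =>
    rw [Function.iterate_succ_apply']
    exact (avg_continuous hh ih).locallyIntegrable

theorem iterate_avg_continuous {h : ℝ} (hh : h ≠ 0) {f : ℝ → ℝ}
    (hf : LocallyIntegrable f volume) {n : ℕ} (hn : n ≠ 0) : Continuous ((avg h)^[n] f) := by
  obtain ⟨n, rfl⟩ := Nat.exists_eq_succ_of_ne_zero hn
  rw [Function.iterate_succ_apply']
  exact avg_continuous hh (locallyIntegrable_iterate_avg hh hf n)

theorem avg_shift (h a : ℝ) (f : ℝ → ℝ) : avg h (fun x => f (x + a)) = fun x => avg h f (x + a) := by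
  funext x
  simp only [avg]
  congr 1
  funext s
  ring_nf

theorem iterate_avg_shift (h a : ℝ) (f : ℝ → ℝ) (n : ℕ) :
    (avg h)^[n] (fun x => f (x + a)) = fun x => (avg h)^[n] f (x + a) := by
  induction n with
  | zero => rfl
  | succ n ih => rw [Function.iterate_succ_apply', ih, avg_shift, Function.iterate_succ_apply']

theorem iterate_avg_neg (h : ℝ) (f : ℝ → ℝ) (n : ℕ) :
    (avg (-h))^[n] f = fun x => (avg h)^[n] f (x + n * h) := by
  induction n with
  | zero => simp
  | succ n ih =>
    funext x
    rw [Function.iterate_succ_apply', ih, avg_neg, avg_shift, Function.iterate_succ_apply']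
    push_cast
    ring_nf

theorem periodic_avg {h P : ℝ} {f : ℝ → ℝ} (hf : Function.Periodic f P) :
    Function.Periodic (avg h f) P := by
  have h1 : (fun x => f (x + P)) = f := funext hf
  intro x
  have := congrFun (avg_shift h P f) x
  rw [h1] at this
  exact this.symm

theorem periodic_iterate_avg {h P : ℝ} {f : ℝ → ℝ} (hf : Function.Periodic f P) (n : ℕ) :
    Function.Periodic ((avg h)^[n] f) P := by
  induction n with
  | zero => exact hf
  | succ n ih =>
    rw [Function.iterate_succ_apply']
    exact periodic_avg ih

theorem intervalIntegrable_comp_avg {h : ℝ} {f : ℝ → ℝ} (hf : LocallyIntegrable f volume) (x : ℝ) :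
    IntervalIntegrable (fun s => f (x - h * s)) volume 0 1 := by
  rcases eq_or_ne h 0 with rfl | hh
  · simp
  · have h1 := (intervalIntegrable_of_locallyIntegrable hf (x - h * 0) (x - h * 1)).comp_sub_left x
    have h2 := h1.comp_mul_left (c := h)
    simpa [hh] using h2

theorem avg_sub {h : ℝ} {f g : ℝ → ℝ} (hf : LocallyIntegrable f volume)
    (hg : LocallyIntegrable g volume) (x : ℝ) :
    avg h (fun y => f y - g y) x = avg h f x - avg h g x :=
  intervalIntegral.integral_sub (intervalIntegrable_comp_avg hf x) (intervalIntegrable_comp_avg hg x)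

theorem avg_add {h : ℝ} {f g : ℝ → ℝ} (hf : LocallyIntegrable f volume)
    (hg : LocallyIntegrable g volume) (x : ℝ) :
    avg h (fun y => f y + g y) x = avg h f x + avg h g x :=
  intervalIntegral.integral_add (intervalIntegrable_comp_avg hf x) (intervalIntegrable_comp_avg hg x)

theorem avg_const_mul (h a : ℝ) (f : ℝ → ℝ) (x : ℝ) :
    avg h (fun y => a * f y) x = a * avg h f x :=
  intervalIntegral.integral_const_mul _ _

theorem avg_const (h a : ℝ) : avg h (fun _ => a) = fun _ => a := by
  funext x; simp [avg]

theorem iterate_avg_const_mul (h a : ℝ) (f : ℝ → ℝ) (n : ℕ) :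
    (avg h)^[n] (fun y => a * f y) = fun x => a * (avg h)^[n] f x := by
  induction n with
  | zero => rfl
  | succ n ih =>
    funext x
    rw [Function.iterate_succ_apply', ih, avg_const_mul, Function.iterate_succ_apply']

theorem iterate_avg_sub {h : ℝ} (hh : h ≠ 0) {f g : ℝ → ℝ} (hf : LocallyIntegrable f volume)
    (hg : LocallyIntegrable g volume) (n : ℕ) :
    (avg h)^[n] (fun y => f y - g y) = fun x => (avg h)^[n] f x - (avg h)^[n] g x := by
  induction n with
  | zero => rfl
  | succ n ih =>
    funext x
    rw [Function.iterate_succ_apply', ih, avg_sub (locallyIntegrable_iterate_avg hh hf n)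
      (locallyIntegrable_iterate_avg hh hg n), Function.iterate_succ_apply',
      Function.iterate_succ_apply']

theorem iterate_avg_add {h : ℝ} (hh : h ≠ 0) {f g : ℝ → ℝ} (hf : LocallyIntegrable f volume)
    (hg : LocallyIntegrable g volume) (n : ℕ) :
    (avg h)^[n] (fun y => f y + g y) = fun x => (avg h)^[n] f x + (avg h)^[n] g x := by
  induction n with
  | zero => rfl
  | succ n ih =>
    funext x
    rw [Function.iterate_succ_apply', ih, avg_add (locallyIntegrable_iterate_avg hh hf n)
      (locallyIntegrable_iterate_avg hh hg n), Function.iterate_succ_apply',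
      Function.iterate_succ_apply']

theorem locallyIntegrable_comp_add {f : ℝ → ℝ} (hf : LocallyIntegrable f volume) (a : ℝ) :
    LocallyIntegrable (fun x => f (x + a)) volume := by
  rw [locallyIntegrable_iff]
  intro K hK
  have hK' : IsCompact ((fun x => x + a) '' K) := hK.image (by fun_prop)
  have h1 := hf.integrableOn_isCompact hK'
  have h2 := (measurePreserving_add_right (volume : Measure ℝ) a).integrableOn_image
    (measurableEmbedding_addRight a) (f := f) (s := K)
  exact h2.1 h1

theorem locallyIntegrable_diff {h : ℝ} {f : ℝ → ℝ} (hf : LocallyIntegrable f volume) :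
    LocallyIntegrable (diff h f) volume :=
  hf.sub (by simpa [sub_eq_add_neg] using locallyIntegrable_comp_add hf (-h))

theorem iterate_avg_diff {h : ℝ} (hh : h ≠ 0) (a : ℝ) {f : ℝ → ℝ} (hf : LocallyIntegrable f volume)
    (n : ℕ) : (avg h)^[n] (diff a f) = diff a ((avg h)^[n] f) := by
  have h1 : diff a f = fun y => f y - (fun x => f (x + -a)) y := by
    funext y; simp [diff, sub_eq_add_neg]
  rw [h1, iterate_avg_sub hh hf (locallyIntegrable_comp_add hf _), iterate_avg_shift]
  rfl

theorem locallyIntegrable_iterate_diff {h : ℝ} {f : ℝ → ℝ} (hf : LocallyIntegrable f volume)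
    (n : ℕ) : LocallyIntegrable ((diff h)^[n] f) volume := by
  induction n with
  | zero => exact hf
  | succ n ih =>
    rw [Function.iterate_succ_apply']
    exact locallyIntegrable_diff ih

theorem iterate_avg_iterate_diff {h : ℝ} (hh : h ≠ 0) (a : ℝ) {f : ℝ → ℝ}
    (hf : LocallyIntegrable f volume) (n k : ℕ) :
    (avg h)^[n] ((diff a)^[k] f) = (diff a)^[k] ((avg h)^[n] f) := by
  induction k with
  | zero => rfl
  | succ k ih =>
    rw [Function.iterate_succ_apply', iterate_avg_diff hh a (locallyIntegrable_iterate_diff hf k),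
      ih, Function.iterate_succ_apply']

theorem abs_avg_le {h M : ℝ} {f : ℝ → ℝ} (hf : ∀ x, |f x| ≤ M) (x : ℝ) : |avg h f x| ≤ M := by
  have := intervalIntegral.norm_integral_le_of_norm_le_const (a := 0) (b := 1) (C := M)
    (f := fun s => f (x - h * s)) (fun s _ => hf _)
  simpa [avg] using this

theorem abs_iterate_avg_le {h M : ℝ} {f : ℝ → ℝ} (hf : ∀ x, |f x| ≤ M) (n : ℕ) (x : ℝ) :
    |(avg h)^[n] f x| ≤ M := by
  induction n generalizing x with
  | zero => exact hf x
  | succ n ih =>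
    rw [Function.iterate_succ_apply']
    exact abs_avg_le ih x

theorem abs_avg_le_of_ae {h M : ℝ} (hh : h ≠ 0) {f : ℝ → ℝ} (hf : ∀ᵐ x, |f x| ≤ M) (x : ℝ) :
    |avg h f x| ≤ M := by
  have hM : 0 ≤ M := by
    obtain ⟨y, hy⟩ := hf.exists
    exact (abs_nonneg _).trans hy
  have h1 : f =ᵐ[volume] fun y => if |f y| ≤ M then f y else 0 := by
    filter_upwards [hf] with y hy
    simp [hy]
  rw [avg_congr_ae hh h1]
  apply abs_avg_le
  intro y
  split_ifs with h2
  · exact h2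
  · simpa

theorem abs_iterate_avg_le_of_ae {h M : ℝ} (hh : h ≠ 0) {f : ℝ → ℝ} (hf : ∀ᵐ x, |f x| ≤ M)
    (n : ℕ) : ∀ᵐ x, |(avg h)^[n] f x| ≤ M := by
  cases n with
  | zero => exact hf
  | succ n =>
    rw [Function.iterate_succ_apply]
    exact .of_forall (abs_iterate_avg_le (abs_avg_le_of_ae hh hf) n)

/-! ### Contraction and adjointness of averages. -/

/-- The mean value of the square dominates the square of the mean value. -/
theorem sq_avg_le {h : ℝ} {f : ℝ → ℝ} (hf : LocallyIntegrable f volume)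
    (hf2 : LocallyIntegrable (fun x => f x ^ 2) volume) (x : ℝ) :
    avg h f x ^ 2 ≤ avg h (fun y => f y ^ 2) x := by
  set m := avg h f x with hm
  have h1 := intervalIntegrable_comp_avg (h := h) hf x
  have h2 := intervalIntegrable_comp_avg (h := h) hf2 x
  have h3 : 0 ≤ ∫ s in (0 : ℝ)..1, (f (x - h * s) - m) ^ 2 :=
    intervalIntegral.integral_nonneg zero_le_one fun s _ => sq_nonneg _
  have h4 : ∫ s in (0 : ℝ)..1, (f (x - h * s) - m) ^ 2
      = avg h (fun y => f y ^ 2) x - 2 * m * avg h f x + m ^ 2 := by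
    simp only [avg]
    rw [← intervalIntegral.integral_const_mul, ← intervalIntegral.integral_sub h2 (h1.const_mul _)]
    have h5 : m ^ 2 = ∫ s in (0 : ℝ)..1, m ^ 2 := by simp
    rw [h5, ← intervalIntegral.integral_add (h2.sub (h1.const_mul _)) (by simp)]
    congr 1
    funext s
    ring
  rw [h4, ← hm] at h3
  nlinarith

/-- The joint integrability needed for Fubini: the inner integral of the norm is a difference of two
primitives, hence continuous in s. -/
theorem integrable_comp_add_mul {h a b : ℝ} {f : ℝ → ℝ} (hf : LocallyIntegrable f volume)
    (hfm : Measurable f) :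
    Integrable (fun p : ℝ × ℝ => f (p.1 + h * p.2))
      ((volume.restrict (Set.Ioc a b)).prod (volume.restrict (Set.Ioc 0 1))) := by
  have hm : Measurable fun p : ℝ × ℝ => f (p.1 + h * p.2) :=
    hfm.comp (by fun_prop)
  rw [integrable_prod_iff' hm.aestronglyMeasurable]
  rcases lt_or_ge b a with hab | hab
  · simp [Set.Ioc_eq_empty_of_le hab.le]
  have hn : LocallyIntegrable (fun x => ‖f x‖) volume := fun x => (hf x).norm
  constructor
  · refine .of_forall fun s => ?_
    exact ((locallyIntegrable_comp_add hf (h * s)).integrableOn_isCompact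
      (isCompact_Icc (a := a) (b := b))).mono_set Set.Ioc_subset_Icc_self
  · have h1 : (fun s => ∫ x, ‖f (x + h * s)‖ ∂volume.restrict (Set.Ioc a b)) = fun s =>
        (∫ x in (0 : ℝ)..(b + h * s), ‖f x‖) - ∫ x in (0 : ℝ)..(a + h * s), ‖f x‖ := by
      funext s
      have hi := intervalIntegrable_of_locallyIntegrable hn
      rw [← intervalIntegral.integral_of_le hab,
        intervalIntegral.integral_comp_add_right (fun x => ‖f x‖),
        intervalIntegral.integral_interval_sub_left (hi _ _) (hi _ _)]
    have hc : Continuous fun y => ∫ x in (0 : ℝ)..y, ‖f x‖ :=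
      intervalIntegral.continuous_primitive (intervalIntegrable_of_locallyIntegrable hn) 0
    have h2 : Continuous fun s =>
        (∫ x in (0 : ℝ)..(b + h * s), ‖f x‖) - ∫ x in (0 : ℝ)..(a + h * s), ‖f x‖ :=
      (hc.comp (by fun_prop : Continuous fun s : ℝ => b + h * s)).sub
        (hc.comp (by fun_prop : Continuous fun s : ℝ => a + h * s))
    rw [h1]
    exact (h2.integrableOn_Icc (a := 0) (b := 1)).mono_set Set.Ioc_subset_Icc_self

/-- The common core of adjointness for periodic functions and for compactly supported test
functions: in either case the translation identity holds for each shift h s, and Fubini integrates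
it over s. -/
theorem integral_mul_avg_of_translate {h a b M : ℝ} (hab : a ≤ b) (hh : h ≠ 0) {f g : ℝ → ℝ}
    (hf : LocallyIntegrable f volume) (hg : Measurable g) (hgM : ∀ x, |g x| ≤ M)
    (htr : ∀ s ∈ Set.Ioc (0 : ℝ) 1,
      ∫ x in a..b, f x * g (x - h * s) = ∫ x in a..b, f (x + h * s) * g x) :
    ∫ x in a..b, f x * avg h g x = ∫ x in a..b, avg (-h) f x * g x := by
  -- Fubini needs joint measurability of f (x + h s), so f is replaced by a measurable
  -- representative.
  wlog hfm : Measurable f generalizing f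
  · obtain ⟨f', hf'm, hff'⟩ := hf.aestronglyMeasurable.aemeasurable
    have hf' : LocallyIntegrable f' volume := hf.congr hff'
    have key := this hf' (fun s hs => ?_) hf'm
    · rw [avg_congr_ae (neg_ne_zero.2 hh) hff', ← key]
      apply intervalIntegral.integral_congr_ae
      filter_upwards [hff'] with x hx _
      rw [hx]
    · have h1 : (fun x => f (x + h * s)) =ᵐ[volume] fun x => f' (x + h * s) :=
        (measurePreserving_add_right volume (h * s)).quasiMeasurePreserving.ae_eq_comp hff'
      have e1 : ∫ x in a..b, f' x * g (x - h * s) = ∫ x in a..b, f x * g (x - h * s) := by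
        apply intervalIntegral.integral_congr_ae
        filter_upwards [hff'] with x hx _
        rw [hx]
      have e2 : ∫ x in a..b, f' (x + h * s) * g x = ∫ x in a..b, f (x + h * s) * g x := by
        apply intervalIntegral.integral_congr_ae
        filter_upwards [h1] with x hx _
        rw [hx]
      rw [e1, e2, htr s hs]
  simp only [intervalIntegral.integral_of_le hab] at htr ⊢
  have hfi : Integrable f (volume.restrict (Set.Ioc a b)) :=
    (hf.integrableOn_isCompact (isCompact_Icc (a := a) (b := b))).mono_set Set.Ioc_subset_Icc_self
  have i1 : Integrable (Function.uncurry fun x s => f x * g (x - h * s))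
      ((volume.restrict (Set.Ioc a b)).prod (volume.restrict (Set.Ioc (0 : ℝ) 1))) := by
    refine (hfi.comp_fst (volume.restrict (Set.Ioc (0 : ℝ) 1))).mul_bdd (c := M) ?_ ?_
    · exact (hg.comp (by fun_prop : Measurable fun p : ℝ × ℝ => p.1 - h * p.2)).aestronglyMeasurable
    · exact .of_forall fun p => hgM _
  have i2 : Integrable (Function.uncurry fun x s => f (x + h * s) * g x)
      ((volume.restrict (Set.Ioc a b)).prod (volume.restrict (Set.Ioc (0 : ℝ) 1))) := by
    refine (integrable_comp_add_mul hf hfm).mul_bdd (c := M) ?_ ?_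
    · exact (hg.comp measurable_fst).aestronglyMeasurable
    · exact .of_forall fun p => hgM _
  have e1 : ∀ x, f x * avg h g x = ∫ s in Set.Ioc (0 : ℝ) 1, f x * g (x - h * s) := fun x => by
    rw [avg, intervalIntegral.integral_of_le zero_le_one, integral_const_mul]
  have e2 : ∀ x, avg (-h) f x * g x = ∫ s in Set.Ioc (0 : ℝ) 1, f (x + h * s) * g x := fun x => by
    rw [avg, intervalIntegral.integral_of_le zero_le_one, integral_mul_const]
    simp
  simp only [e1, e2]
  rw [integral_integral_swap i1, integral_integral_swap i2]
  exact setIntegral_congr_fun measurableSet_Ioc htr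

theorem intervalIntegral_comp_add_of_periodic {P : ℝ} {F : ℝ → ℝ} (hF : Function.Periodic F P)
    (a : ℝ) : ∫ x in (0 : ℝ)..P, F (x + a) = ∫ x in (0 : ℝ)..P, F x := by
  rw [intervalIntegral.integral_comp_add_right]
  have := hF.intervalIntegral_add_eq a 0
  rw [zero_add] at this ⊢
  rw [← this, add_comm P a]

theorem integral_mul_avg {h P M : ℝ} (hP : 0 ≤ P) (hh : h ≠ 0) {f g : ℝ → ℝ}
    (hfP : Function.Periodic f P) (hgP : Function.Periodic g P)
    (hf : LocallyIntegrable f volume) (hg : Measurable g) (hgM : ∀ x, |g x| ≤ M) :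
    ∫ x in (0 : ℝ)..P, f x * avg h g x = ∫ x in (0 : ℝ)..P, avg (-h) f x * g x := by
  refine integral_mul_avg_of_translate hP hh hf hg hgM fun s _ => ?_
  have h1 : Function.Periodic (fun x => f x * g (x - h * s)) P := fun x => by
    have := hgP (x - h * s)
    rw [sub_add_eq_add_sub] at this
    simp only [hfP x, this]
  rw [← intervalIntegral_comp_add_of_periodic h1 (h * s)]
  simp

theorem locallyIntegrable_of_bounded {M : ℝ} {g : ℝ → ℝ} (hg : Measurable g)
    (hgM : ∀ x, |g x| ≤ M) : LocallyIntegrable g volume := by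
  rw [locallyIntegrable_iff]
  intro K hK
  exact Measure.integrableOn_of_bounded (M := M) hK.measure_lt_top.ne
    hg.aestronglyMeasurable (.of_forall hgM)

theorem measurable_iterate_avg {h M : ℝ} (hh : h ≠ 0) {g : ℝ → ℝ} (hg : Measurable g)
    (hgM : ∀ x, |g x| ≤ M) (n : ℕ) : Measurable ((avg h)^[n] g) := by
  cases n with
  | zero => exact hg
  | succ n => exact (iterate_avg_continuous hh (locallyIntegrable_of_bounded hg hgM)
      n.succ_ne_zero).measurable

theorem integral_mul_iterate_avg {h P M : ℝ} (hP : 0 ≤ P) (hh : h ≠ 0) {f g : ℝ → ℝ}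
    (hfP : Function.Periodic f P) (hgP : Function.Periodic g P)
    (hf : LocallyIntegrable f volume) (hg : Measurable g) (hgM : ∀ x, |g x| ≤ M) (n : ℕ) :
    ∫ x in (0 : ℝ)..P, f x * (avg h)^[n] g x = ∫ x in (0 : ℝ)..P, (avg (-h))^[n] f x * g x := by
  induction n generalizing f with
  | zero => rfl
  | succ n ih =>
    rw [Function.iterate_succ_apply', integral_mul_avg hP hh hfP (periodic_iterate_avg hgP n) hf
      (measurable_iterate_avg hh hg hgM n) (abs_iterate_avg_le hgM n),
      ih (periodic_avg hfP) (avg_continuous (neg_ne_zero.2 hh) hf).locallyIntegrable,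
      Function.iterate_succ_apply]

theorem integral_mul_avg_of_hasCompactSupport {h : ℝ} (hh : h ≠ 0) {f φ : ℝ → ℝ}
    (hf : LocallyIntegrable f volume) (hφ : Continuous φ) (hφs : HasCompactSupport φ) :
    ∫ x, f x * avg h φ x = ∫ x, avg (-h) f x * φ x := by
  obtain ⟨M, hM⟩ := hφ.bounded_above_of_compact_support hφs
  obtain ⟨R, hR0, hR⟩ := hφs.exists_pos_le_norm
  -- Translating by at most |h| enlarges the support radius by at most |h|, so every integral can be
  -- restricted to the same interval.
  have hz : ∀ s ∈ Set.Icc (0 : ℝ) 1, ∀ x, R + |h| ≤ |x| → φ (x - h * s) = 0 := fun s hs x hx => by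
    apply hR
    have h1 : |h * s| ≤ |h| := by
      rw [abs_mul, abs_of_nonneg hs.1]
      exact mul_le_of_le_one_right (abs_nonneg _) hs.2
    have h2 := abs_sub_abs_le_abs_sub x (h * s)
    rw [Real.norm_eq_abs]
    linarith
  set L := R + |h| with hL
  have hL0 : -L ≤ L := by
    have := abs_nonneg h
    linarith
  have hset : ∀ F : ℝ → ℝ, (∀ x, L ≤ |x| → F x = 0) → ∫ x, F x = ∫ x in (-L)..L, F x := by
    intro F hF
    rw [intervalIntegral.integral_of_le hL0, setIntegral_eq_integral_of_forall_compl_eq_zero]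
    intro x hx
    apply hF
    by_contra hlt
    push Not at hlt
    rw [abs_lt] at hlt
    exact hx ⟨hlt.1, hlt.2.le⟩
  have hz0 : ∀ x, L ≤ |x| → φ x = 0 := fun x hx => by
    simpa using hz 0 ⟨le_rfl, zero_le_one⟩ x hx
  rw [hset, hset]
  · refine integral_mul_avg_of_translate hL0 hh hf hφ.measurable hM fun s hs => ?_
    rw [← hset, ← hset]
    · rw [← integral_add_right_eq_self (fun x => f x * φ (x - h * s)) (h * s)]
      simp
    · intro x hx; simp [hz0 x hx]
    · intro x hx; simp [hz s ⟨hs.1.le, hs.2⟩ x hx]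
  · intro x hx; simp [hz0 x hx]
  · intro x hx
    have : avg h φ x = ∫ s in (0 : ℝ)..1, (0 : ℝ) := by
      apply intervalIntegral.integral_congr
      intro s hs
      rw [Set.uIcc_of_le zero_le_one] at hs
      exact hz s hs x hx
    simp [this]

/-- Averaging is a contraction of `L²` over one period. -/
theorem integral_sq_avg_le {h P : ℝ} (hP : 0 ≤ P) (hh : h ≠ 0) {f : ℝ → ℝ}
    (hfP : Function.Periodic f P) (hf : LocallyIntegrable f volume)
    (hf2 : LocallyIntegrable (fun x => f x ^ 2) volume) :
    ∫ x in (0 : ℝ)..P, avg h f x ^ 2 ≤ ∫ x in (0 : ℝ)..P, f x ^ 2 := by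
  have h1 : ∫ x in (0 : ℝ)..P, avg h f x ^ 2 ≤ ∫ x in (0 : ℝ)..P, avg h (fun y => f y ^ 2) x := by
    apply intervalIntegral.integral_mono_on hP
    · exact ((avg_continuous hh hf).pow 2).intervalIntegrable _ _
    · exact (avg_continuous hh hf2).intervalIntegrable _ _
    · exact fun x _ => sq_avg_le hf hf2 x
  -- Adjointness against the constant 1 shows that averaging preserves the integral over a period.
  have h2 := integral_mul_avg (h := -h) hP (neg_ne_zero.2 hh) (f := fun x => f x ^ 2)
    (g := fun _ => 1) (M := 1) (fun x => by simp only [hfP x]) (fun _ => rfl) hf2 measurable_const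
    (by simp)
  simp only [avg_const, neg_neg, mul_one] at h2
  rw [h2]
  exact h1

theorem locallyIntegrable_sq_avg {h : ℝ} (hh : h ≠ 0) {f : ℝ → ℝ}
    (hf : LocallyIntegrable f volume) : LocallyIntegrable (fun x => avg h f x ^ 2) volume :=
  ((avg_continuous hh hf).pow 2).locallyIntegrable

theorem locallyIntegrable_sq_iterate_avg {h : ℝ} (hh : h ≠ 0) {f : ℝ → ℝ}
    (hf : LocallyIntegrable f volume)
    (hf2 : LocallyIntegrable (fun x => f x ^ 2) volume) (n : ℕ) :
    LocallyIntegrable (fun x => (avg h)^[n] f x ^ 2) volume := by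
  cases n with
  | zero => exact hf2
  | succ n =>
    rw [Function.iterate_succ_apply']
    exact locallyIntegrable_sq_avg hh (locallyIntegrable_iterate_avg hh hf n)

theorem integral_sq_iterate_avg_le {h P : ℝ} (hP : 0 ≤ P) (hh : h ≠ 0) {f : ℝ → ℝ}
    (hfP : Function.Periodic f P) (hf : LocallyIntegrable f volume)
    (hf2 : LocallyIntegrable (fun x => f x ^ 2) volume) (n : ℕ) :
    ∫ x in (0 : ℝ)..P, (avg h)^[n] f x ^ 2 ≤ ∫ x in (0 : ℝ)..P, f x ^ 2 := by
  induction n with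
  | zero => rfl
  | succ n ih =>
    rw [Function.iterate_succ_apply']
    exact (integral_sq_avg_le hP hh (periodic_iterate_avg hfP n)
      (locallyIntegrable_iterate_avg hh hf n)
      (locallyIntegrable_sq_iterate_avg hh hf hf2 n)).trans ih

theorem integral_eq_sum_avg_neg {h : ℝ} (hh : h ≠ 0) {f : ℝ → ℝ} (hf : LocallyIntegrable f volume)
    (N : ℕ) : ∫ x in (0 : ℝ)..(N * h), f x = h * ∑ j ∈ Finset.range N, avg (-h) f (j * h) := by
  have h1 := intervalIntegral.sum_integral_adjacent_intervals (a := fun j : ℕ => (j : ℝ) * h)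
    (μ := volume) (f := f) (n := N) fun k _ => intervalIntegrable_of_locallyIntegrable hf _ _
  simp only [Nat.cast_zero, zero_mul] at h1
  rw [← h1, Finset.mul_sum]
  refine Finset.sum_congr rfl fun j _ => ?_
  rw [avg_neg, avg_eq hh, ← mul_assoc, mul_inv_cancel₀ hh, one_mul]
  push_cast
  ring_nf

/-- Sampling a forward average is a contraction from `L²` over one period to `ℓ²`. -/
theorem sum_sq_iterate_avg_le {h : ℝ} (hh : 0 < h) {f : ℝ → ℝ} {N : ℕ}
    (hfP : Function.Periodic f (N * h)) (hf : LocallyIntegrable f volume)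
    (hf2 : LocallyIntegrable (fun x => f x ^ 2) volume) {n : ℕ} (hn : n ≠ 0) :
    h * ∑ j ∈ Finset.range N, ((avg (-h))^[n] f (j * h)) ^ 2 ≤ ∫ x in (0 : ℝ)..(N * h), f x ^ 2 := by
  obtain ⟨n, rfl⟩ := Nat.exists_eq_succ_of_ne_zero hn
  have hh' : -h ≠ 0 := neg_ne_zero.2 hh.ne'
  have hF := locallyIntegrable_iterate_avg hh' hf n
  have hF2 := locallyIntegrable_sq_iterate_avg hh' hf hf2 n
  refine le_trans ?_ (integral_sq_iterate_avg_le (by positivity) hh' hfP hf hf2 n)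
  rw [integral_eq_sum_avg_neg hh.ne' hF2]
  gcongr with j hj
  rw [Function.iterate_succ_apply']
  exact sq_avg_le hF hF2 _

/-! ### Splines as iterated averages of step functions. -/

/-- The backward difference of a sequence. -/
def bdiff (c : ℤ → ℝ) (j : ℤ) : ℝ := c j - c (j - 1)

/-- The step function with value `c i` on `[i h, (i + 1) h)`. -/
noncomputable def step (h : ℝ) (c : ℤ → ℝ) (x : ℝ) : ℝ := c ⌊x / h⌋

/-- The spline of degree `m` with B-spline coefficients `c` on the mesh of width `h`. -/
noncomputable def spl (h : ℝ) (m : ℕ) (c : ℤ → ℝ) : ℝ → ℝ := (avg h)^[m] (step h c)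

theorem spl_succ (h : ℝ) (m : ℕ) (c : ℤ → ℝ) : spl h (m + 1) c = avg h (spl h m c) :=
  Function.iterate_succ_apply' _ _ _

theorem iterate_avg_spl (h : ℝ) (n m : ℕ) (c : ℤ → ℝ) :
    (avg h)^[n] (spl h m c) = spl h (n + m) c :=
  (Function.iterate_add_apply _ _ _ _).symm

theorem measurable_step (h : ℝ) (c : ℤ → ℝ) : Measurable (step h c) :=
  (measurable_from_top (f := c)).comp (Int.measurable_floor.comp (measurable_id.div_const h))

theorem locallyIntegrable_step {h : ℝ} (hh : 0 < h) (c : ℤ → ℝ) :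
    LocallyIntegrable (step h c) volume := by
  rw [locallyIntegrable_iff]
  intro K hK
  obtain ⟨a, ha⟩ := hK.bddBelow
  obtain ⟨b, hb⟩ := hK.bddAbove
  obtain ⟨M, hM⟩ := (((Set.finite_Icc ⌊a / h⌋ ⌊b / h⌋).image fun j => |c j|)).bddAbove
  refine Measure.integrableOn_of_bounded (M := M) hK.measure_lt_top.ne
    (measurable_step h c).aestronglyMeasurable ?_
  rw [ae_restrict_iff' hK.measurableSet]
  refine .of_forall fun x hx => hM ⟨⌊x / h⌋, ⟨?_, ?_⟩, rfl⟩
  · exact Int.floor_le_floor (div_le_div_of_nonneg_right (ha hx) hh.le)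
  · exact Int.floor_le_floor (div_le_div_of_nonneg_right (hb hx) hh.le)

theorem locallyIntegrable_spl {h : ℝ} (hh : 0 < h) (m : ℕ) (c : ℤ → ℝ) :
    LocallyIntegrable (spl h m c) volume :=
  locallyIntegrable_iterate_avg hh.ne' (locallyIntegrable_step hh c) m

theorem abs_spl_le {h M : ℝ} {c : ℤ → ℝ} (hc : ∀ j, |c j| ≤ M) (m : ℕ) (x : ℝ) :
    |spl h m c x| ≤ M :=
  abs_iterate_avg_le (fun _ => hc _) m x

theorem measurable_spl {h : ℝ} (hh : 0 < h) (m : ℕ) (c : ℤ → ℝ) : Measurable (spl h m c) := by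
  cases m with
  | zero => exact measurable_step h c
  | succ n =>
    rw [spl_succ]
    exact (avg_continuous hh.ne' (locallyIntegrable_spl hh n c)).measurable

theorem continuous_spl {h : ℝ} (hh : 0 < h) {m : ℕ} (hm : m ≠ 0) (c : ℤ → ℝ) :
    Continuous (spl h m c) :=
  iterate_avg_continuous hh.ne' (locallyIntegrable_step hh c) hm

theorem spl_shift {h : ℝ} (hh : h ≠ 0) (m : ℕ) (c : ℤ → ℝ) (k : ℤ) (x : ℝ) :
    spl h m c (x + k * h) = spl h m (fun j => c (j + k)) x := by
  have h1 : step h (fun j => c (j + k)) = fun x => step h c (x + k * h) := by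
    funext y
    rw [step, step, add_div, mul_div_cancel_right₀ _ hh, Int.floor_add_intCast]
  rw [spl, spl, h1, iterate_avg_shift]

theorem spl_sub {h : ℝ} (hh : 0 < h) (m : ℕ) (c d : ℤ → ℝ) :
    spl h m (fun j => c j - d j) = fun x => spl h m c x - spl h m d x :=
  iterate_avg_sub hh.ne' (locallyIntegrable_step hh c) (locallyIntegrable_step hh d) m

theorem spl_add {h : ℝ} (hh : 0 < h) (m : ℕ) (c d : ℤ → ℝ) :
    spl h m (fun j => c j + d j) = fun x => spl h m c x + spl h m d x :=
  iterate_avg_add hh.ne' (locallyIntegrable_step hh c) (locallyIntegrable_step hh d) m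

theorem spl_const_mul (h : ℝ) (m : ℕ) (a : ℝ) (c : ℤ → ℝ) :
    spl h m (fun j => a * c j) = fun x => a * spl h m c x :=
  iterate_avg_const_mul h a (step h c) m

theorem spl_const (h : ℝ) (m : ℕ) (a : ℝ) : spl h m (fun _ => a) = fun _ => a := by
  induction m with
  | zero => rfl
  | succ m ih => rw [spl_succ, ih, avg_const]

theorem diff_spl {h : ℝ} (hh : 0 < h) (m : ℕ) (c : ℤ → ℝ) :
    diff h (spl h m c) = spl h m (bdiff c) := by
  have h1 : bdiff c = fun j => c j - (fun i => c (i + -1)) j := rfl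
  rw [h1, spl_sub hh]
  funext x
  rw [← spl_shift hh.ne']
  simp [diff, sub_eq_add_neg]

theorem iterate_diff_spl {h : ℝ} (hh : 0 < h) (m k : ℕ) (c : ℤ → ℝ) :
    (diff h)^[k] (spl h m c) = spl h m (bdiff^[k] c) := by
  induction k with
  | zero => rfl
  | succ k ih => rw [Function.iterate_succ_apply', ih, diff_spl hh, Function.iterate_succ_apply']

theorem periodic_spl {h : ℝ} (hh : h ≠ 0) {N : ℕ} {c : ℤ → ℝ} (hc : Function.Periodic c (N : ℤ))
    (m : ℕ) : Function.Periodic (spl h m c) (N * h) := by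
  intro x
  have h1 : (fun j => c (j + (N : ℤ))) = c := funext hc
  have := spl_shift hh m c N x
  rw [h1] at this
  exact_mod_cast this

/-- Reduction to the unit mesh. It makes the Gram matrix independent of h, which is the source of
constants independent of N. -/
theorem spl_scale {h : ℝ} (hh : h ≠ 0) (m : ℕ) (c : ℤ → ℝ) (x : ℝ) :
    spl h m c x = spl 1 m c (x / h) := by
  induction m generalizing x with
  | zero => simp [spl, step]
  | succ m ih =>
    rw [spl_succ, spl_succ, avg, avg]
    congr 1
    funext s
    rw [ih, sub_div, mul_div_cancel_left₀ _ hh, one_mul]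

/-- Locality: each average reaches back by at most one cell, so only finitely many coefficients act
at a given point. -/
theorem spl_congr {m : ℕ} {c d : ℤ → ℝ} {t : ℝ}
    (hcd : ∀ k : ℤ, t - m - 1 < k → (k : ℝ) ≤ t → c k = d k) : spl 1 m c t = spl 1 m d t := by
  induction m generalizing t with
  | zero =>
    simp only [spl, step, Function.iterate_zero, id_eq, div_one]
    refine hcd _ ?_ (Int.floor_le t)
    simp
  | succ m ih =>
    rw [spl_succ, spl_succ, avg, avg]
    apply intervalIntegral.integral_congr
    intro s hs
    rw [Set.uIcc_of_le zero_le_one] at hs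
    refine ih fun k hk1 hk2 => hcd k ?_ ?_
    · push_cast
      linarith [hs.2]
    · linarith [hs.1]

theorem exists_bound_of_periodic {N : ℕ} (hN : N ≠ 0) {c : ℤ → ℝ}
    (hc : Function.Periodic c (N : ℤ)) : ∃ M, ∀ j, |c j| ≤ M := by
  obtain ⟨M, hM⟩ := (((Set.finite_Ico (0 : ℤ) N).image fun j => |c j|)).bddAbove
  have hN' : (0 : ℤ) < N := by exact_mod_cast Nat.pos_of_ne_zero hN
  refine ⟨M, fun j => ?_⟩
  obtain ⟨y, hy, hyj⟩ := hc.exists_mem_Ico₀ hN' j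
  rw [hyj]
  exact hM ⟨y, hy, rfl⟩

theorem periodic_bdiff {N : ℤ} {c : ℤ → ℝ} (hc : Function.Periodic c N) :
    Function.Periodic (bdiff c) N := fun j => by
  have := hc (j - 1)
  rw [sub_add_eq_add_sub] at this
  rw [bdiff, bdiff, hc j, this]

theorem periodic_iterate_bdiff {N : ℤ} {c : ℤ → ℝ} (hc : Function.Periodic c N) (k : ℕ) :
    Function.Periodic (bdiff^[k] c) N := by
  induction k with
  | zero => exact hc
  | succ k ih =>
    rw [Function.iterate_succ_apply']
    exact periodic_bdiff ih

/-! ### The Gram matrix and duality with B-splines. -/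

/-- The (infinite, Toeplitz) Gram matrix of the B-splines of degree `m`, applied to a sequence. -/
noncomputable def gram (m : ℕ) (c : ℤ → ℝ) (j : ℤ) : ℝ := spl 1 (m + 1 + m) c (j + (m + 1))

/-- The m + 1 forward means are backward means shifted by (m + 1) h; together with the m means
inside the spline they give degree 2m + 1. This explains the degree and the shift in `gram`. -/
theorem iterate_avg_neg_spl {h : ℝ} (hh : h ≠ 0) (m : ℕ) (c : ℤ → ℝ) (j : ℤ) :
    (avg (-h))^[m + 1] (spl h m c) (j * h) = gram m c j := by
  rw [iterate_avg_neg, iterate_avg_spl, gram]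
  beta_reduce
  rw [spl_scale hh]
  congr 1
  field_simp
  push_cast
  rfl

theorem gram_sub (m : ℕ) (c d : ℤ → ℝ) (j : ℤ) :
    gram m (fun i => c i - d i) j = gram m c j - gram m d j := by
  rw [gram, spl_sub one_pos]; rfl

theorem gram_const_mul (m : ℕ) (a : ℝ) (c : ℤ → ℝ) (j : ℤ) :
    gram m (fun i => a * c i) j = a * gram m c j := by
  rw [gram, spl_const_mul]; rfl

/-- Translation invariance of the Toeplitz matrix: this is why derivatives of the projection satisfy
the same system. -/
theorem gram_bdiff (m : ℕ) (c : ℤ → ℝ) : gram m (bdiff c) = bdiff (gram m c) := by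
  funext j
  rw [gram, ← diff_spl one_pos, bdiff, gram, gram, diff]
  push_cast
  ring_nf

theorem gram_iterate_bdiff (m k : ℕ) (c : ℤ → ℝ) :
    gram m (bdiff^[k] c) = bdiff^[k] (gram m c) := by
  induction k with
  | zero => rfl
  | succ k ih => rw [Function.iterate_succ_apply', gram_bdiff, ih, Function.iterate_succ_apply']

theorem gram_congr {m : ℕ} {c d : ℤ → ℝ} {j : ℤ} (hcd : ∀ k, |k - j| ≤ m + 1 → c k = d k) :
    gram m c j = gram m d j := by
  refine spl_congr fun k h1 h2 => hcd k ?_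
  push_cast at h1
  have h3 : ((j - (m + 1) : ℤ) : ℝ) < k := by push_cast; linarith
  have h4 : (k : ℝ) ≤ ((j + (m + 1) : ℤ) : ℝ) := by push_cast; linarith
  rw [Int.cast_lt] at h3
  rw [Int.cast_le] at h4
  rw [abs_le]
  constructor <;> linarith

theorem abs_gram_le {M : ℝ} {c : ℤ → ℝ} (hc : ∀ j, |c j| ≤ M) (m : ℕ) (j : ℤ) :
    |gram m c j| ≤ M := abs_spl_le hc _ _

theorem periodic_gram {N : ℕ} {c : ℤ → ℝ} (hc : Function.Periodic c (N : ℤ)) (m : ℕ) :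
    Function.Periodic (gram m c) (N : ℤ) := fun j => by
  have := periodic_spl one_ne_zero hc (m + 1 + m) (j + (m + 1))
  rw [gram, gram, ← this]
  push_cast
  ring_nf

/-- The forward mean at node j runs over the cell on which the step function is the constant c j. -/
theorem avg_neg_mul_step {h : ℝ} (hh : 0 < h) (f : ℝ → ℝ) (c : ℤ → ℝ) (j : ℤ) :
    avg (-h) (fun x => f x * step h c x) (j * h) = avg (-h) f (j * h) * c j := by
  rw [avg, avg, ← intervalIntegral.integral_mul_const]
  apply intervalIntegral.integral_congr_ae
  -- At s = 1 the floor already jumps to the next cell.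
  have h1 : ∀ᵐ s : ℝ, s ≠ 1 := by simp [ae_iff]
  filter_upwards [h1] with s hs1 hs
  rw [Set.uIoc_of_le zero_le_one] at hs
  congr 1
  rw [step]
  congr 1
  rw [show j * h - -h * s = (j + s) * h by ring, mul_div_cancel_right₀ _ hh.ne', Int.floor_eq_iff]
  exact ⟨by linarith [hs.1], by linarith [lt_of_le_of_ne hs.2 hs1]⟩

theorem locallyIntegrable_mul_bounded {M : ℝ} {f g : ℝ → ℝ} (hf : LocallyIntegrable f volume)
    (hg : Measurable g) (hgM : ∀ x, |g x| ≤ M) : LocallyIntegrable (fun x => f x * g x) volume := by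
  rw [locallyIntegrable_iff] at hf ⊢
  exact fun K hK => (hf K hK).mul_bdd (c := M) hg.aestronglyMeasurable (.of_forall hgM)

/-- Duality between a periodic function and a spline, in terms of the coefficients of the latter. -/
theorem integral_mul_spl {h : ℝ} (hh : 0 < h) {N : ℕ} (hN : N ≠ 0) {f : ℝ → ℝ} {c : ℤ → ℝ}
    (hfP : Function.Periodic f (N * h)) (hf : LocallyIntegrable f volume)
    (hc : Function.Periodic c (N : ℤ)) (m : ℕ) :
    ∫ x in (0 : ℝ)..(N * h), f x * spl h m c x =
      h * ∑ j ∈ Finset.range N, (avg (-h))^[m + 1] f (j * h) * c j := by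
  obtain ⟨M, hM⟩ := exists_bound_of_periodic hN hc
  have hsM : ∀ x, |step h c x| ≤ M := fun x => hM _
  rw [spl, integral_mul_iterate_avg (g := step h c) (by positivity) hh.ne' hfP
    (periodic_spl hh.ne' hc 0) hf
    (measurable_step h c) hsM]
  have hF := locallyIntegrable_iterate_avg (neg_ne_zero.2 hh.ne') hf m
  rw [integral_eq_sum_avg_neg hh.ne' (locallyIntegrable_mul_bounded hF (measurable_step h c) hsM)]
  congr 1
  refine Finset.sum_congr rfl fun j _ => ?_
  have := avg_neg_mul_step hh ((avg (-h))^[m] f) c j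
  rw [Function.iterate_succ_apply']
  exact_mod_cast this

theorem integral_spl_sq {h : ℝ} (hh : 0 < h) {N : ℕ} (hN : N ≠ 0) {c : ℤ → ℝ}
    (hc : Function.Periodic c (N : ℤ)) (m : ℕ) :
    ∫ x in (0 : ℝ)..(N * h), spl h m c x ^ 2 = h * ∑ j ∈ Finset.range N, gram m c j * c j := by
  simp only [sq]
  rw [integral_mul_spl hh hN (periodic_spl hh.ne' hc m) (locallyIntegrable_spl hh m c) hc]
  congr 1
  refine Finset.sum_congr rfl fun j _ => ?_
  rw [← iterate_avg_neg_spl hh.ne']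
  norm_cast

theorem integral_step_sq {h : ℝ} (hh : 0 < h) {N : ℕ} (hN : N ≠ 0) {c : ℤ → ℝ}
    (hc : Function.Periodic c (N : ℤ)) :
    ∫ x in (0 : ℝ)..(N * h), step h c x ^ 2 = h * ∑ j ∈ Finset.range N, c j ^ 2 := by
  have := integral_mul_spl hh hN (periodic_spl hh.ne' hc 0) (locallyIntegrable_spl hh 0 c) hc 0
  simp only [spl, Function.iterate_zero, id_eq, zero_add, Function.iterate_one, ← sq] at this
  rw [this]
  congr 1
  refine Finset.sum_congr rfl fun j _ => ?_
  have := avg_neg_mul_step hh (fun _ => 1) c j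
  simp only [one_mul, avg_const] at this
  rw [sq, ← this]
  norm_cast

theorem locallyIntegrable_step_sq {h : ℝ} (hh : 0 < h) (c : ℤ → ℝ) :
    LocallyIntegrable (fun x => step h c x ^ 2) volume :=
  locallyIntegrable_step hh fun j => c j ^ 2

theorem locallyIntegrable_spl_sq {h : ℝ} (hh : 0 < h) (m : ℕ) (c : ℤ → ℝ) :
    LocallyIntegrable (fun x => spl h m c x ^ 2) volume :=
  locallyIntegrable_sq_iterate_avg hh.ne' (locallyIntegrable_step hh c)
    (locallyIntegrable_step_sq hh c) m

theorem integral_spl_sq_le {h : ℝ} (hh : 0 < h) {N : ℕ} (hN : N ≠ 0) {c : ℤ → ℝ}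
    (hc : Function.Periodic c (N : ℤ)) (m : ℕ) :
    ∫ x in (0 : ℝ)..(N * h), spl h m c x ^ 2 ≤ h * ∑ j ∈ Finset.range N, c j ^ 2 := by
  rw [← integral_step_sq hh hN hc]
  exact integral_sq_iterate_avg_le (by positivity) hh.ne' (periodic_spl hh.ne' hc 0)
    (locallyIntegrable_step hh c) (locallyIntegrable_step_sq hh c) m

theorem sum_sq_gram_le {N : ℕ} (hN : N ≠ 0) {c : ℤ → ℝ} (hc : Function.Periodic c (N : ℤ))
    (m : ℕ) : ∑ j ∈ Finset.range N, gram m c j ^ 2 ≤ ∑ j ∈ Finset.range N, c j ^ 2 := by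
  have h1 := sum_sq_iterate_avg_le one_pos (periodic_spl one_ne_zero hc m)
    (locallyIntegrable_spl one_pos m c) (locallyIntegrable_spl_sq one_pos m c) m.succ_ne_zero
  have h2 := h1.trans (integral_spl_sq_le one_pos hN hc m)
  rw [one_mul, one_mul] at h2
  refine le_of_eq_of_le (Finset.sum_congr rfl fun j _ => ?_) h2
  rw [← iterate_avg_neg_spl one_ne_zero]
  norm_cast

/-! ### Local linear independence and coercivity of the Gram matrix. -/

theorem continuousOn_spl (m : ℕ) (c : ℤ → ℝ) : ContinuousOn (spl 1 m c) (Set.Ioo 0 1) := by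
  rcases eq_or_ne m 0 with rfl | hm
  · refine (continuousOn_const (c := c 0)).congr fun x hx => ?_
    have : ⌊x⌋ = 0 := Int.floor_eq_iff.2 ⟨by simpa using hx.1.le, by simpa using hx.2⟩
    simp [spl, step, this]
  · exact (continuous_spl one_pos hm c).continuousOn

/-- Local linear independence of the B-splines on one mesh interval. -/
theorem eq_zero_of_spl_eq_zero {m : ℕ} {c : ℤ → ℝ} (h0 : ∀ x ∈ Set.Ioo (0 : ℝ) 1, spl 1 m c x = 0) :
    ∀ j : ℕ, j ≤ m → c (-(j : ℤ)) = 0 := by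
  induction m generalizing c with
  | zero =>
    intro j hj
    have h1 := h0 (1 / 2) ⟨by norm_num, by norm_num⟩
    have h2 : ⌊(2 : ℝ)⁻¹⌋ = 0 := Int.floor_eq_iff.2 ⟨by norm_num, by norm_num⟩
    obtain rfl : j = 0 := by omega
    simpa [spl, step, h2] using h1
  | succ m ih =>
    -- A spline vanishing on the cell has vanishing derivative there, and that derivative is the
    -- spline of one degree less with differenced coefficients.
    have hf : ∀ x ∈ Set.Ioo (0 : ℝ) 1, spl 1 m (bdiff c) x = 0 := by
      intro x hx
      have hloc := locallyIntegrable_spl one_pos m (bdiff c)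
      have hd : HasDerivAt (fun y => ∫ t in x..y, spl 1 m (bdiff c) t) (spl 1 m (bdiff c) x) x :=
        intervalIntegral.integral_hasDerivAt_right
          (intervalIntegrable_of_locallyIntegrable hloc _ _)
          hloc.aestronglyMeasurable.stronglyMeasurableAtFilter
          ((continuousOn_spl m (bdiff c)).continuousAt (Ioo_mem_nhds hx.1 hx.2))
      have hz : (fun y => ∫ t in x..y, spl 1 m (bdiff c) t) =ᶠ[nhds x] fun _ => 0 := by
        filter_upwards [Ioo_mem_nhds hx.1 hx.2] with y hy
        have := avg_sub_avg one_ne_zero (locallyIntegrable_spl one_pos m c) y x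
        rw [diff_spl one_pos, ← spl_succ, h0 y hy, h0 x hx] at this
        simpa using this.symm
      exact hd.unique ((hasDerivAt_const x (0 : ℝ)).congr_of_eventuallyEq hz)
    have h1 : ∀ j : ℕ, j ≤ m + 1 → c (-(j : ℤ)) = c 0 := by
      intro j
      induction j with
      | zero => simp
      | succ j ihj =>
        intro hj
        have h2 := ih hf j (by omega)
        rw [bdiff, sub_eq_zero, ihj (by omega)] at h2
        rw [h2]
        congr 1
        push_cast
        ring
    -- All active coefficients now agree, so the spline equals their common value on the cell, and
    -- that value is zero.
    have h2 : spl 1 (m + 1) c (1 / 2) = spl 1 (m + 1) (fun _ => c 0) (1 / 2) := by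
      refine spl_congr fun k hk1 hk2 => ?_
      have hk3 : ((-(m + 2) : ℤ) : ℝ) < k := by push_cast at hk1 ⊢; linarith
      have hk4 : (k : ℝ) < ((1 : ℤ) : ℝ) := by push_cast; linarith
      rw [Int.cast_lt] at hk3 hk4
      have := h1 (-k).toNat (by omega)
      rwa [Int.toNat_of_nonneg (by omega), neg_neg] at this
    rw [h0 _ ⟨by norm_num, by norm_num⟩, spl_const] at h2
    intro j hj
    rw [h1 j hj]
    exact h2.symm

/-- Extension of a finite vector of coefficients by zero to the indices `-m, …, 0`. -/
noncomputable def extendCoeff (m : ℕ) : (Fin (m + 1) → ℝ) →ₗ[ℝ] (ℤ → ℝ) where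
  toFun a k := if h : (-k).toNat < m + 1 then a ⟨(-k).toNat, h⟩ else 0
  map_add' a b := by
    funext k
    simp only [Pi.add_apply]
    split_ifs <;> simp
  map_smul' r a := by
    funext k
    simp only [Pi.smul_apply, smul_eq_mul, RingHom.id_apply]
    split_ifs <;> simp

theorem memLp_spl (m : ℕ) (c : ℤ → ℝ) {M : ℝ} (hc : ∀ j, |c j| ≤ M) :
    MemLp (spl 1 m c) 2 (volume.restrict (Set.Ioc (0 : ℝ) 1)) :=
  MemLp.of_bound (measurable_spl one_pos m c).aestronglyMeasurable M
    (.of_forall fun x => abs_spl_le hc m x)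

theorem abs_extendCoeff_le (m : ℕ) (a : Fin (m + 1) → ℝ) (k : ℤ) : |extendCoeff m a k| ≤ ‖a‖ := by
  simp only [extendCoeff, LinearMap.coe_mk, AddHom.coe_mk]
  split_ifs with h
  · exact norm_le_pi_norm a _
  · simp

/-- The spline with given active coefficients, as an element of `L²` of one mesh interval. -/
noncomputable def splLp (m : ℕ) :
    (Fin (m + 1) → ℝ) →ₗ[ℝ] Lp ℝ 2 (volume.restrict (Set.Ioc (0 : ℝ) 1)) where
  toFun a := (memLp_spl m (extendCoeff m a) (abs_extendCoeff_le m a)).toLp _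
  map_add' a b := by
    rw [← MemLp.toLp_add]
    congr 1
    rw [map_add]
    exact spl_add one_pos m _ _
  map_smul' r a := by
    rw [RingHom.id_apply, ← MemLp.toLp_const_smul]
    congr 1
    rw [map_smul]
    exact spl_const_mul 1 m r _

theorem norm_splLp_sq (m : ℕ) (a : Fin (m + 1) → ℝ) :
    ‖splLp m a‖ ^ 2 = ∫ x in (0 : ℝ)..1, spl 1 m (extendCoeff m a) x ^ 2 := by
  rw [← real_inner_self_eq_norm_sq, L2.inner_def, intervalIntegral.integral_of_le zero_le_one]
  apply integral_congr_ae
  filter_upwards [(memLp_spl m (extendCoeff m a) (abs_extendCoeff_le m a)).coeFn_toLp] with x hx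
  simp only [splLp, LinearMap.coe_mk, AddHom.coe_mk, hx]
  simp [sq]

theorem ker_splLp (m : ℕ) : (splLp m).ker = ⊥ := by
  rw [LinearMap.ker_eq_bot']
  intro a ha
  have h1 : spl 1 m (extendCoeff m a) =ᵐ[volume.restrict (Set.Ioo (0 : ℝ) 1)] fun _ => 0 := by
    have h2 := (memLp_spl m (extendCoeff m a) (abs_extendCoeff_le m a)).coeFn_toLp
    have h3 : (memLp_spl m (extendCoeff m a) (abs_extendCoeff_le m a)).toLp _ = 0 := ha
    rw [h3] at h2
    have h4 := h2.symm.trans (Lp.coeFn_zero ℝ 2 (volume.restrict (Set.Ioc (0 : ℝ) 1)))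
    exact ae_restrict_of_ae_restrict_of_subset Set.Ioo_subset_Ioc_self h4
  have h2 : Set.EqOn (spl 1 m (extendCoeff m a)) (fun _ => 0) (Set.Ioo 0 1) :=
    Measure.eqOn_open_of_ae_eq h1 isOpen_Ioo (continuousOn_spl m _) continuousOn_const
  have h3 := eq_zero_of_spl_eq_zero (fun x hx => h2 hx)
  funext j
  have h4 := h3 j (by omega)
  have h5 : (j : ℕ) ≤ m := by omega
  simpa [extendCoeff, h5] using h4

/-- On one cell only the m + 1 coefficients with indices -m, …, 0 act. The map from them to L² of
the cell is linear and injective on a finite-dimensional space, hence bounded below. -/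
theorem exists_local_lower_bound (m : ℕ) :
    ∃ κ > 0, ∀ c : ℤ → ℝ, κ * c 0 ^ 2 ≤ ∫ x in (0 : ℝ)..1, spl 1 m c x ^ 2 := by
  obtain ⟨K, hK, hL⟩ := (splLp m).exists_antilipschitzWith (ker_splLp m)
  have hK' : (0 : ℝ) < K := hK
  refine ⟨((K : ℝ) ^ 2)⁻¹, by positivity, fun c => ?_⟩
  set a : Fin (m + 1) → ℝ := fun i => c (-(i : ℤ)) with ha
  have h1 : ∫ x in (0 : ℝ)..1, spl 1 m c x ^ 2 = ‖splLp m a‖ ^ 2 := by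
    rw [norm_splLp_sq]
    apply intervalIntegral.integral_congr_ae
    have hne : ∀ᵐ s : ℝ, s ≠ 1 := by simp [ae_iff]
    filter_upwards [hne] with x hx1 hx
    rw [Set.uIoc_of_le zero_le_one] at hx
    congr 1
    refine spl_congr fun k hk1 hk2 => ?_
    have hx2 := lt_of_le_of_ne hx.2 hx1
    have hk3 : ((-(m + 1) : ℤ) : ℝ) < k := by push_cast at hk1 ⊢; linarith [hx.1]
    have hk4 : (k : ℝ) < ((1 : ℤ) : ℝ) := by push_cast; linarith
    rw [Int.cast_lt] at hk3 hk4
    have hk5 : (-k).toNat < m + 1 := by omega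
    simp only [extendCoeff, LinearMap.coe_mk, AddHom.coe_mk, hk5, dite_true, ha]
    rw [Int.toNat_of_nonneg (by omega), neg_neg]
  have h2 : ‖a‖ ≤ K * ‖splLp m a‖ := by
    have := hL.le_mul_dist a 0
    simpa using this
  have h3 : |c 0| ≤ ‖a‖ := by
    have := norm_le_pi_norm a 0
    simpa [ha] using this
  have h4 : c 0 ^ 2 ≤ (K * ‖splLp m a‖) ^ 2 := by
    rw [← sq_abs]
    exact pow_le_pow_left₀ (abs_nonneg _) (h3.trans h2) 2
  rw [h1, inv_mul_le_iff₀ (by positivity), ← mul_pow]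
  exact h4

/-- Uniform ellipticity of the Gram matrix. -/
theorem exists_gram_coercive (m : ℕ) : ∃ κ : ℝ, 0 < κ ∧ κ ≤ 1 ∧ ∀ N : ℕ, N ≠ 0 → ∀ c : ℤ → ℝ,
    Function.Periodic c (N : ℤ) →
      κ * ∑ j ∈ Finset.range N, c j ^ 2 ≤ ∑ j ∈ Finset.range N, gram m c j * c j := by
  obtain ⟨κ, hκ, hloc⟩ := exists_local_lower_bound m
  -- The cap at 1 guarantees 0 ≤ 1 - κ² < 1, the contraction factor used later.
  refine ⟨min κ 1, lt_min hκ one_pos, min_le_right _ _, fun N hN c hc => ?_⟩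
  have h1 := integral_spl_sq one_pos hN hc m
  rw [integral_eq_sum_avg_neg one_ne_zero (locallyIntegrable_spl_sq one_pos m c), one_mul,
    one_mul] at h1
  rw [← h1, Finset.mul_sum]
  refine Finset.sum_le_sum fun j _ => ?_
  have h2 := hloc fun i => c (i + j)
  have h3 : avg (-1) (fun x => spl 1 m c x ^ 2) (j * 1)
      = ∫ x in (0 : ℝ)..1, spl 1 m (fun i => c (i + j)) x ^ 2 := by
    rw [avg]
    congr 1
    funext s
    rw [← spl_shift one_ne_zero]
    congr 2
    push_cast
    ring
  rw [h3]
  refine le_trans ?_ h2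
  rw [zero_add]
  exact mul_le_mul_of_nonneg_right (min_le_left _ _) (sq_nonneg _)

/-- Expanding ∑ (G c - κ c)² ≥ 0 and inserting coercivity replaces a Cauchy–Schwarz argument. -/
theorem sum_sq_le_of_coercive {m N : ℕ} {κ : ℝ} {c : ℤ → ℝ}
    (hκ : κ * ∑ j ∈ Finset.range N, c j ^ 2 ≤ ∑ j ∈ Finset.range N, gram m c j * c j)
    (hκ0 : 0 ≤ κ) :
    κ ^ 2 * ∑ j ∈ Finset.range N, c j ^ 2 ≤ ∑ j ∈ Finset.range N, gram m c j ^ 2 := by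
  have h1 : 0 ≤ ∑ j ∈ Finset.range N, (gram m c j - κ * c j) ^ 2 :=
    Finset.sum_nonneg fun _ _ => sq_nonneg _
  have h2 : ∑ j ∈ Finset.range N, (gram m c j - κ * c j) ^ 2
      = ∑ j ∈ Finset.range N, gram m c j ^ 2 - 2 * κ * ∑ j ∈ Finset.range N, gram m c j * c j
        + κ ^ 2 * ∑ j ∈ Finset.range N, c j ^ 2 := by
    rw [Finset.mul_sum, Finset.mul_sum, ← Finset.sum_sub_distrib, ← Finset.sum_add_distrib]
    exact Finset.sum_congr rfl fun j _ => by ring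
  nlinarith

/-! ### Inverting the Gram matrix in the supremum norm. -/

/-- The error propagation operator of the Richardson iteration for the Gram matrix. -/
noncomputable def richardson (m : ℕ) (κ : ℝ) (c : ℤ → ℝ) (j : ℤ) : ℝ := c j - κ * gram m c j

theorem periodic_richardson {m N : ℕ} {κ : ℝ} {c : ℤ → ℝ} (hc : Function.Periodic c (N : ℤ)) :
    Function.Periodic (richardson m κ c) (N : ℤ) := fun j => by
  rw [richardson, richardson, hc j, periodic_gram hc m j]

theorem periodic_iterate_richardson {m N : ℕ} {κ : ℝ} {c : ℤ → ℝ}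
    (hc : Function.Periodic c (N : ℤ)) (n : ℕ) :
    Function.Periodic ((richardson m κ)^[n] c) (N : ℤ) := by
  induction n with
  | zero => exact hc
  | succ n ih =>
    rw [Function.iterate_succ_apply']
    exact periodic_richardson ih

/-- In the expanded square, coercivity bounds the cross term by -2κ² and the contraction property of
G bounds the last term by κ², relative to ∑ c². -/
theorem sum_sq_richardson_le {m N : ℕ} (hN : N ≠ 0) {κ : ℝ} (hκ0 : 0 ≤ κ) {c : ℤ → ℝ}
    (hc : Function.Periodic c (N : ℤ))
    (hκ : κ * ∑ j ∈ Finset.range N, c j ^ 2 ≤ ∑ j ∈ Finset.range N, gram m c j * c j) :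
    ∑ j ∈ Finset.range N, richardson m κ c j ^ 2
      ≤ (1 - κ ^ 2) * ∑ j ∈ Finset.range N, c j ^ 2 := by
  have h2 : ∑ j ∈ Finset.range N, richardson m κ c j ^ 2
      = ∑ j ∈ Finset.range N, c j ^ 2 - 2 * κ * ∑ j ∈ Finset.range N, gram m c j * c j
        + κ ^ 2 * ∑ j ∈ Finset.range N, gram m c j ^ 2 := by
    rw [Finset.mul_sum, Finset.mul_sum, ← Finset.sum_sub_distrib, ← Finset.sum_add_distrib]
    exact Finset.sum_congr rfl fun j _ => by rw [richardson]; ring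
  have h3 := sum_sq_gram_le hN hc m
  nlinarith [mul_le_mul_of_nonneg_left h3 (sq_nonneg κ), mul_le_mul_of_nonneg_left hκ hκ0]

theorem iterate_richardson_congr {m : ℕ} {κ : ℝ} {c d : ℤ → ℝ} {n : ℕ} {j : ℤ}
    (hcd : ∀ k, |k - j| ≤ n * (m + 1) → c k = d k) :
    (richardson m κ)^[n] c j = (richardson m κ)^[n] d j := by
  induction n generalizing j with
  | zero => exact hcd j (by simp)
  | succ n ih =>
    rw [Function.iterate_succ_apply', Function.iterate_succ_apply', richardson, richardson]
    have hm : (0 : ℤ) ≤ m + 1 := by positivity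
    rw [ih fun k hk => hcd k (hk.trans (by push_cast; nlinarith)),
      gram_congr fun k hk => ih fun i hi => hcd i ?_]
    have := abs_sub_le i k j
    push_cast
    linarith

/-- Decay in the supremum norm, with a loss due to the growth of the bandwidth. -/
theorem sq_iterate_richardson_le {m : ℕ} {κ : ℝ} (hκ0 : 0 ≤ κ) (hκ1 : κ ≤ 1)
    (hκ : ∀ N : ℕ, N ≠ 0 → ∀ c : ℤ → ℝ, Function.Periodic c (N : ℤ) →
      κ * ∑ j ∈ Finset.range N, c j ^ 2 ≤ ∑ j ∈ Finset.range N, gram m c j * c j)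
    {c : ℤ → ℝ} {M : ℝ} (hM : ∀ j, |c j| ≤ M) (n : ℕ) (j : ℤ) :
    (richardson m κ)^[n] c j ^ 2 ≤ (1 - κ ^ 2) ^ n * ((2 * (n * (m + 1)) + 1 : ℕ) * M ^ 2) := by
  -- The number of indices within reach W = n (m + 1) of j, so one period holds exactly that window.
  set P : ℕ := 2 * (n * (m + 1)) + 1 with hP
  have hP0 : P ≠ 0 := by omega
  have hPpos : (0 : ℤ) < P := by omega
  set W : ℤ := n * (m + 1) with hW
  have hPW : (P : ℤ) = 2 * W + 1 := by rw [hP, hW]; push_cast; ring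
  -- The window of c around j, continued P-periodically. By locality the n-th iterate at j does not
  -- notice the change, and the periodic ℓ² contraction becomes available for a merely bounded c.
  set d : ℤ → ℝ := fun k => c (j - W + (k - j + W) % P) with hd
  have hdP : Function.Periodic d (P : ℤ) := fun k => by
    simp only [hd]
    rw [show k + P - j + W = k - j + W + P by ring, Int.add_emod_right]
  have h1 : (richardson m κ)^[n] c j = (richardson m κ)^[n] d j := by
    refine iterate_richardson_congr fun k hk => ?_
    rw [← hW, abs_le] at hk
    simp only [hd]
    rw [Int.emod_eq_of_lt (by linarith) (by linarith)]
    congr 1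
    ring
  have hq : 0 ≤ 1 - κ ^ 2 := by nlinarith
  have h2 : ∀ n : ℕ, ∑ i ∈ Finset.range P, (richardson m κ)^[n] d i ^ 2
      ≤ (1 - κ ^ 2) ^ n * ∑ i ∈ Finset.range P, d i ^ 2 := by
    intro n
    induction n with
    | zero => simp
    | succ n ih =>
      have hper := periodic_iterate_richardson (m := m) (κ := κ) hdP n
      rw [Function.iterate_succ_apply', pow_succ', mul_assoc]
      exact (sum_sq_richardson_le hP0 hκ0 hper (hκ P hP0 _ hper)).trans
        (mul_le_mul_of_nonneg_left ih hq)
  have h3 : ∑ i ∈ Finset.range P, d i ^ 2 ≤ P * M ^ 2 := by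
    refine (Finset.sum_le_card_nsmul _ _ (M ^ 2) fun i _ => ?_).trans_eq (by simp)
    rw [← sq_abs]
    exact pow_le_pow_left₀ (abs_nonneg _) (hM _) 2
  rw [h1]
  obtain ⟨y, hy, hyj⟩ := (periodic_iterate_richardson (m := m) (κ := κ) hdP n).exists_mem_Ico₀
    hPpos j
  rw [hyj]
  have hy1 := hy.1
  have hy2 := hy.2
  have h4 : (richardson m κ)^[n] d y ^ 2 ≤ ∑ i ∈ Finset.range P, (richardson m κ)^[n] d i ^ 2 := by
    have := Finset.single_le_sum (f := fun i : ℕ => (richardson m κ)^[n] d i ^ 2)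
      (fun i _ => sq_nonneg _) (Finset.mem_range.2 (by omega : y.toNat < P))
    simpa [Int.toNat_of_nonneg hy.1] using this
  exact (h4.trans (h2 n)).trans (mul_le_mul_of_nonneg_left h3 (pow_nonneg hq n))

theorem iterate_richardson_sub (m : ℕ) (κ : ℝ) (c d : ℤ → ℝ) (n : ℕ) :
    (richardson m κ)^[n] (fun j => c j - κ * d j)
      = fun j => (richardson m κ)^[n] c j - κ * (richardson m κ)^[n] d j := by
  induction n with
  | zero => rfl
  | succ n ih =>
    funext j
    rw [Function.iterate_succ_apply', ih, richardson,
      gram_sub m _ (fun j => κ * (richardson m κ)^[n] d j), gram_const_mul,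
      Function.iterate_succ_apply', Function.iterate_succ_apply', richardson, richardson]
    ring

theorem abs_iterate_richardson_le {m : ℕ} {κ : ℝ} (hκ0 : 0 ≤ κ) (hκ1 : κ ≤ 1) {d : ℤ → ℝ} {D : ℝ}
    (hD : ∀ j, |d j| ≤ D) (n : ℕ) (j : ℤ) : |(richardson m κ)^[n] d j| ≤ 2 ^ n * D := by
  induction n generalizing j with
  | zero => simpa using hD j
  | succ n ih =>
    rw [Function.iterate_succ_apply', richardson]
    have h1 := abs_gram_le ih m j
    have h2 := abs_sub ((richardson m κ)^[n] d j) (κ * gram m ((richardson m κ)^[n] d) j)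
    rw [abs_mul, abs_of_nonneg hκ0] at h2
    have h3 := mul_le_mul hκ1 h1 (abs_nonneg _) zero_le_one
    have h4 := ih j
    rw [pow_succ]
    linarith

/-- Telescoping: consecutive iterates differ by κ times an iterate of `gram m c`, and each iteration
at most doubles the supremum norm, giving 1 + 2 + ⋯ + 2^(n-1) < 2^n. -/
theorem abs_sub_iterate_richardson_le {m : ℕ} {κ : ℝ} (hκ0 : 0 ≤ κ) (hκ1 : κ ≤ 1) {c : ℤ → ℝ}
    {D : ℝ} (hD : ∀ j, |gram m c j| ≤ D) (n : ℕ) (j : ℤ) :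
    |c j - (richardson m κ)^[n] c j| ≤ 2 ^ n * D := by
  have hD0 : 0 ≤ D := (abs_nonneg _).trans (hD 0)
  induction n with
  | zero => simpa using hD0
  | succ n ih =>
    have h1 : (richardson m κ)^[n + 1] c
        = fun j => (richardson m κ)^[n] c j - κ * (richardson m κ)^[n] (gram m c) j := by
      rw [Function.iterate_succ_apply]
      exact iterate_richardson_sub m κ c (gram m c) n
    rw [h1]
    have h2 := abs_iterate_richardson_le (m := m) hκ0 hκ1 hD n j
    have h3 := abs_add_le (c j - (richardson m κ)^[n] c j) (κ * (richardson m κ)^[n] (gram m c) j)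
    rw [abs_mul, abs_of_nonneg hκ0] at h3
    have h4 := mul_le_mul hκ1 h2 (abs_nonneg _) zero_le_one
    rw [pow_succ, ← sub_add]
    linarith

/-- The inverse of the Gram matrix is bounded in the supremum norm. -/
theorem exists_abs_le_of_abs_gram_le (m : ℕ) : ∃ C : ℝ, 0 ≤ C ∧ ∀ (c : ℤ → ℝ) (M D : ℝ),
    (∀ j, |c j| ≤ M) → (∀ j, |gram m c j| ≤ D) → ∀ j, |c j| ≤ C * D := by
  obtain ⟨κ, hκ0, hκ1, hκ⟩ := exists_gram_coercive m
  have hq : 0 ≤ 1 - κ ^ 2 := by nlinarith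
  have hq1 : 1 - κ ^ 2 < 1 := by nlinarith
  have hlim : Filter.Tendsto (fun n : ℕ => (1 - κ ^ 2) ^ n * ((2 * (n * (m + 1)) + 1 : ℕ) : ℝ))
      Filter.atTop (nhds 0) := by
    have h1 := tendsto_self_mul_const_pow_of_lt_one hq hq1
    have h2 := tendsto_pow_atTop_nhds_zero_of_lt_one hq hq1
    have h3 := (h1.const_mul (2 * (m + 1 : ℝ))).add h2
    simp only [mul_zero, add_zero] at h3
    refine h3.congr fun n => ?_
    push_cast
    ring
  -- The value 1/4 for squares makes the n-th iterate at most half the supremum of |c|; this n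
  -- depends on m only.
  obtain ⟨n, hn⟩ := (hlim.eventually (gt_mem_nhds (by norm_num : (0 : ℝ) < 1 / 4))).exists
  refine ⟨2 * 2 ^ n, by positivity, fun c M D hM hD => ?_⟩
  have hbdd : BddAbove (Set.range fun j => |c j|) := ⟨M, by rintro _ ⟨j, rfl⟩; exact hM j⟩
  set S := ⨆ j, |c j| with hS
  have hcS : ∀ j, |c j| ≤ S := fun j => le_ciSup hbdd j
  have hS0 : 0 ≤ S := (abs_nonneg _).trans (hcS 0)
  have h1 : ∀ j, |c j| ≤ S / 2 + 2 ^ n * D := by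
    intro j
    have h2 := sq_iterate_richardson_le hκ0.le hκ1 hκ hcS n j
    have h3 : (richardson m κ)^[n] c j ^ 2 ≤ (S / 2) ^ 2 := by
      rw [← mul_assoc] at h2
      have := mul_le_mul_of_nonneg_right hn.le (sq_nonneg S)
      linarith
    have h4 := abs_le_of_sq_le_sq h3 (by positivity)
    have h5 := abs_sub_iterate_richardson_le hκ0.le hκ1 hD n j
    have h6 := abs_sub_abs_le_abs_sub (c j) ((richardson m κ)^[n] c j)
    linarith
  -- Absorbing S / 2 is legitimate because S is finite, and it produces the factor 2 in the
  -- constant. The a priori bound M enters only through this finiteness.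
  have h2 : S ≤ S / 2 + 2 ^ n * D := ciSup_le h1
  intro j
  have := hcS j
  linarith

/-! ### Iterated averages are exactly the periodic splines. -/

theorem hasDerivAt_avg {h : ℝ} (hh : h ≠ 0) {f : ℝ → ℝ} (hf : Continuous f) (x : ℝ) :
    HasDerivAt (avg h f) (h⁻¹ * diff h f x) x := by
  have h1 : avg h f = fun x => avg h f 0 + h⁻¹ * ∫ t in (0 : ℝ)..x, diff h f t := by
    funext x
    rw [← avg_sub_avg hh hf.locallyIntegrable]; ring
  have hd : Continuous (diff h f) := hf.sub (hf.comp (continuous_sub_right h))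
  rw [h1]
  exact ((hd.integral_hasStrictDerivAt 0 x).hasDerivAt.const_mul _).const_add _

theorem deriv_avg {h : ℝ} (hh : h ≠ 0) {f : ℝ → ℝ} (hf : Continuous f) :
    deriv (avg h f) = fun x => h⁻¹ * diff h f x :=
  funext fun x => (hasDerivAt_avg hh hf x).deriv

theorem contDiff_diff {h : ℝ} {n : WithTop ℕ∞} {f : ℝ → ℝ} (hf : ContDiff ℝ n f) :
    ContDiff ℝ n (diff h f) :=
  hf.sub (hf.comp (contDiff_id.sub contDiff_const))

theorem contDiff_avg {h : ℝ} (hh : h ≠ 0) {k : ℕ} {f : ℝ → ℝ} (hf : ContDiff ℝ k f) :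
    ContDiff ℝ (k + 1 : ℕ) (avg h f) := by
  push_cast
  rw [contDiff_succ_iff_deriv]
  refine ⟨fun x => (hasDerivAt_avg hh hf.continuous x).differentiableAt, by simp, ?_⟩
  rw [deriv_avg hh hf.continuous]
  exact contDiff_const.mul (contDiff_diff hf)

theorem contDiff_spl {h : ℝ} (hh : 0 < h) (k : ℕ) (c : ℤ → ℝ) :
    ContDiff ℝ k (spl h (k + 1) c) := by
  induction k with
  | zero => exact contDiff_zero.2 (continuous_spl hh one_ne_zero c)
  | succ k ih =>
    rw [spl_succ]
    exact contDiff_avg hh.ne' ih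

theorem exists_derivative_eq (p : Polynomial ℝ) :
    ∃ q : Polynomial ℝ, q.derivative = p ∧ q.natDegree ≤ p.natDegree + 1 := by
  refine ⟨∑ n ∈ Finset.range (p.natDegree + 1),
    Polynomial.monomial (n + 1) (p.coeff n / (n + 1)), ?_, ?_⟩
  · rw [Polynomial.derivative_sum]
    conv_rhs => rw [p.as_sum_range' (p.natDegree + 1) (Nat.lt_succ_self _)]
    refine Finset.sum_congr rfl fun n _ => ?_
    rw [Polynomial.derivative_monomial]
    have : (n : ℝ) + 1 ≠ 0 := by positivity
    simp [this]
  · refine Polynomial.natDegree_sum_le_of_forall_le _ _ fun n hn => ?_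
    rw [Finset.mem_range] at hn
    exact (Polynomial.natDegree_monomial_le _).trans (by omega)

/-- On cell i the difference of the lower-degree spline involves just the pieces on cells i and i -
1, hence is a polynomial, and a further average integrates it. The integrated formula also handles
the discontinuous case of degree zero. -/
theorem exists_polynomial_eq_spl {h : ℝ} (hh : 0 < h) (m : ℕ) (c : ℤ → ℝ) (i : ℤ) :
    ∃ q : Polynomial ℝ, q.natDegree ≤ m ∧
      ∀ x ∈ Set.Ioo (i * h) ((i + 1) * h), spl h m c x = q.eval x := by
  induction m generalizing i with
  | zero =>
    refine ⟨Polynomial.C (c i), by simp, fun x hx => ?_⟩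
    have : ⌊x / h⌋ = i := by
      rw [Int.floor_eq_iff, le_div_iff₀ hh, div_lt_iff₀ hh]
      exact ⟨hx.1.le, hx.2⟩
    simp [spl, step, this]
  | succ m ih =>
    obtain ⟨p, hp, hpe⟩ := ih i
    obtain ⟨p', hp', hpe'⟩ := ih (i - 1)
    set P := p - p'.comp (Polynomial.X - Polynomial.C h) with hP
    have hPd : P.natDegree ≤ m := by
      refine (Polynomial.natDegree_sub_le_of_le hp (?_ : _ ≤ m)).trans_eq (max_self m)
      refine Polynomial.natDegree_comp_le.trans ?_
      rw [Polynomial.natDegree_X_sub_C, mul_one]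
      exact hp'
    have hPe : ∀ x ∈ Set.Ioo (i * h) ((i + 1) * h), diff h (spl h m c) x = P.eval x := by
      intro x hx
      rw [diff, hpe x hx, hpe' (x - h)]
      · simp [hP]
      · push_cast
        exact ⟨by linarith [hx.1], by linarith [hx.2]⟩
    obtain ⟨Q, hQ, hQd⟩ := exists_derivative_eq P
    set x₀ := (i + 1 / 2) * h with hx₀
    have hx₀m : x₀ ∈ Set.Ioo (i * h) ((i + 1) * h) := by
      rw [hx₀]
      constructor <;> nlinarith
    refine ⟨Polynomial.C (spl h (m + 1) c x₀ - h⁻¹ * Q.eval x₀) + Polynomial.C h⁻¹ * Q, ?_, ?_⟩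
    · refine Polynomial.natDegree_add_le_of_degree_le
        ((Polynomial.natDegree_C _).le.trans (Nat.zero_le _)) ?_
      exact (Polynomial.natDegree_C_mul_le _ _).trans (by omega)
    · intro x hx
      have h1 := avg_sub_avg hh.ne' (locallyIntegrable_spl hh m c) x x₀
      have h2 : ∫ t in x₀..x, diff h (spl h m c) t = Q.eval x - Q.eval x₀ := by
        have h3 : ∫ t in x₀..x, diff h (spl h m c) t = ∫ t in x₀..x, P.eval t := by
          apply intervalIntegral.integral_congr
          intro t ht
          exact hPe t (Set.ordConnected_Ioo.uIcc_subset hx₀m hx ht)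
        rw [h3]
        apply intervalIntegral.integral_eq_sub_of_hasDerivAt
        · intro t _
          have := Q.hasDerivAt t
          rwa [hQ] at this
        · exact P.continuous.intervalIntegrable _ _
      rw [h2, ← spl_succ] at h1
      simp only [Polynomial.eval_add, Polynomial.eval_C, Polynomial.eval_mul]
      linarith

theorem natCast_mul_inv {N : ℕ} (hN : N ≠ 0) : (N : ℝ) * (N : ℝ)⁻¹ = 1 :=
  mul_inv_cancel₀ (Nat.cast_ne_zero.2 hN)

theorem inv_natCast_pos {N : ℕ} (hN : N ≠ 0) : (0 : ℝ) < (N : ℝ)⁻¹ :=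
  inv_pos.2 (Nat.cast_pos.2 (Nat.pos_of_ne_zero hN))

theorem periodic_spl_one {N : ℕ} (hN : N ≠ 0) {c : ℤ → ℝ} (hc : Function.Periodic c (N : ℤ))
    (m : ℕ) : Function.Periodic (spl (N : ℝ)⁻¹ m c) 1 := by
  have := periodic_spl (inv_natCast_pos hN).ne' hc m
  rwa [natCast_mul_inv hN] at this

theorem spl_mem_splineSpace {N : ℕ} (hN : N ≠ 0) {c : ℤ → ℝ} (hc : Function.Periodic c (N : ℤ))
    (m : ℕ) : spl (N : ℝ)⁻¹ (m + 1) c ∈ splineSpace (m + 2) N := by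
  have hh := inv_natCast_pos hN
  refine ⟨periodic_spl_one hN hc _, contDiff_spl hh m c, fun i _ => ?_⟩
  obtain ⟨q, hq, hqe⟩ := exists_polynomial_eq_spl hh (m + 1) c i
  exact ⟨q, hq, fun x hx => hqe x hx⟩

/-- A discrete primitive of h d on all of ℤ, written as an integral so that negative indices need no
separate sum. -/
theorem bdiff_integral_step {h : ℝ} (hh : 0 < h) (d : ℤ → ℝ) :
    bdiff (fun j => ∫ x in (0 : ℝ)..((j + 1) * h), step h d x) = fun j => h * d j := by
  funext j
  have hi := intervalIntegrable_of_locallyIntegrable (locallyIntegrable_step hh d)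
  have h1 := avg_neg_mul_step hh (fun _ => 1) d j
  simp only [one_mul, avg_const] at h1
  rw [avg_neg, avg_eq hh.ne'] at h1
  rw [bdiff, intervalIntegral.integral_interval_sub_left (hi _ _) (hi _ _), ← h1, ← mul_assoc,
    mul_inv_cancel₀ hh.ne', one_mul]
  push_cast
  ring_nf

theorem integral_spl {h : ℝ} (hh : 0 < h) {N : ℕ} (hN : N ≠ 0) {c : ℤ → ℝ}
    (hc : Function.Periodic c (N : ℤ)) (m : ℕ) :
    ∫ x in (0 : ℝ)..(N * h), spl h m c x = h * ∑ j ∈ Finset.range N, c j := by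
  have h1 := integral_mul_spl hh hN (f := fun _ => 1) (fun _ => rfl)
    (locallyIntegrable_const _) hc m
  have h2 : (avg (-h))^[m + 1] (fun _ => (1 : ℝ)) = fun _ => 1 :=
    Function.iterate_fixed (avg_const (-h) 1) _
  simpa [h2] using h1

/-- A periodic primitive of a periodic spline is a periodic spline. -/
theorem exists_spl_eq_of_primitive {N : ℕ} (hN : N ≠ 0) {m : ℕ} {d : ℤ → ℝ}
    (hd : Function.Periodic d (N : ℤ)) {χ : ℝ → ℝ} (hχ : Function.Periodic χ 1)
    (hprim : ∀ x, χ x = χ 0 + ∫ t in (0 : ℝ)..x, spl (N : ℝ)⁻¹ m d t) :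
    ∃ c : ℤ → ℝ, Function.Periodic c (N : ℤ) ∧ χ = spl (N : ℝ)⁻¹ (m + 1) c := by
  have hh := inv_natCast_pos hN
  set h := (N : ℝ)⁻¹ with hdef
  have hNh : (N : ℝ) * h = 1 := natCast_mul_inv hN
  have hi := intervalIntegrable_of_locallyIntegrable (locallyIntegrable_step hh d)
  set a : ℤ → ℝ := fun j => ∫ x in (0 : ℝ)..((j + 1) * h), step h d x with ha
  -- Periodicity of χ forces its derivative to have mean zero, and averaging preserves means;
  -- without this the discrete primitive a would not be periodic.
  have hzero : ∫ x in (0 : ℝ)..1, step h d x = 0 := by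
    have h1 := hprim 1
    have h2 : χ 1 = χ 0 := by simpa using hχ 0
    have h3 := integral_spl hh hN hd m
    have h4 := integral_spl hh hN hd 0
    rw [hNh] at h3 h4
    rw [h3] at h1
    exact h4.trans (by linarith)
  have hper : Function.Periodic (step h d) 1 := periodic_spl_one hN hd 0
  have haP : Function.Periodic a (N : ℤ) := fun j => by
    rw [← sub_eq_zero]
    simp only [ha]
    rw [intervalIntegral.integral_interval_sub_left (hi _ _) (hi _ _)]
    have h1 := hper.intervalIntegral_add_eq ((j + 1) * h) 0
    rw [zero_add, hzero] at h1
    rw [← h1]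
    congr 1
    push_cast
    linear_combination hNh
  have hab : spl h m (bdiff a) = fun x => h * spl h m d x := by
    rw [ha, bdiff_integral_step hh, spl_const_mul]
  -- The spline with coefficients a has the right derivative; the constant sequence κ corrects its
  -- value at 0.
  set κ := χ 0 - spl h (m + 1) a 0 with hκ
  refine ⟨fun j => a j + (fun _ => κ) j, fun j => by simp only [haP j], ?_⟩
  rw [spl_add hh, spl_const]
  funext x
  have h1 := avg_sub_avg hh.ne' (locallyIntegrable_spl hh m a) x 0
  rw [diff_spl hh, hab, intervalIntegral.integral_const_mul, ← mul_assoc,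
    inv_mul_cancel₀ hh.ne', one_mul, ← spl_succ] at h1
  rw [hprim x, hκ]
  linarith

theorem deriv_mem_splineSpace {m N : ℕ} {χ : ℝ → ℝ} (hχ : χ ∈ splineSpace (m + 3) N) :
    deriv χ ∈ splineSpace (m + 2) N := by
  obtain ⟨h1, h2, h3⟩ := hχ
  refine ⟨fun x => ?_, ?_, fun i hi => ?_⟩
  · rw [← deriv_comp_add_const]
    congr 1
    exact funext h1
  · have h4 : ContDiff ℝ ((m : WithTop ℕ∞) + 1) χ := by exact_mod_cast h2
    exact (contDiff_succ_iff_deriv.1 h4).2.2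
  · obtain ⟨q, hq, hqe⟩ := h3 i hi
    refine ⟨q.derivative, (Polynomial.natDegree_derivative_le q).trans (by omega), fun x hx => ?_⟩
    have : χ =ᶠ[nhds x] fun y => q.eval y := by
      filter_upwards [Ioo_mem_nhds hx.1 hx.2] with y hy using hqe y hy
    rw [this.deriv_eq, Polynomial.deriv]

/-- Base case of the induction on the degree: a continuous, piecewise affine function is the
integral of its slopes, since the nodes, where it need not be differentiable, form a countable set.
-/
theorem exists_primitive_step {N : ℕ} (hN : N ≠ 0) {χ : ℝ → ℝ} (hχ : χ ∈ splineSpace 2 N) :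
    ∃ d : ℤ → ℝ, Function.Periodic d (N : ℤ) ∧
      ∀ x, χ x = χ 0 + ∫ t in (0 : ℝ)..x, spl (N : ℝ)⁻¹ 0 d t := by
  have hh := inv_natCast_pos hN
  have hcont := splineSpace_continuous hχ
  obtain ⟨h1, -, h3⟩ := hχ
  set h := (N : ℝ)⁻¹ with hdef
  have hNh : (N : ℝ) * h = 1 := natCast_mul_inv hN
  have hN0 : (N : ℤ) ≠ 0 := by exact_mod_cast hN
  choose! q hq hqe using h3
  -- The slope on cell j, read off from the congruent cell inside the base period.
  set d : ℤ → ℝ := fun j => (q (j % N).toNat).coeff 1 with hd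
  refine ⟨d, fun j => by simp [hd], fun x => ?_⟩
  have key := MeasureTheory.integral_eq_of_hasDerivAt_off_countable χ (step h d) (a := 0) (b := x)
    (s := Set.range fun j : ℤ => (j : ℝ) * h) (Set.countable_range _) hcont.continuousOn ?_
    (intervalIntegrable_of_locallyIntegrable (locallyIntegrable_step hh d) _ _)
  · change χ x = χ 0 + ∫ t in (0 : ℝ)..x, step h d t
    rw [key]; ring
  · rintro y ⟨-, hy⟩
    set j := ⌊y / h⌋ with hj
    have hy1 : j * h ≤ y := by
      rw [← le_div_iff₀ hh]; exact Int.floor_le _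
    have hy2 : y < (j + 1) * h := by
      rw [← div_lt_iff₀ hh]; exact Int.lt_floor_add_one _
    have hy1' : j * h < y := lt_of_le_of_ne hy1 fun he => hy ⟨j, he⟩
    set i := (j % N).toNat with hi
    have hmod := Int.emod_nonneg j hN0
    have hmod' := Int.emod_lt_of_pos j (by omega : (0 : ℤ) < N)
    have hiN : i < N := by omega
    set k := j / (N : ℤ) with hk
    have hjk : (j : ℝ) = i + N * k := by
      have h4 : j = i + N * k := by
        rw [hi, Int.toNat_of_nonneg hmod]
        exact (Int.emod_add_mul_ediv j N).symm
      exact_mod_cast h4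
    have hjh : (j : ℝ) * h = i * h + k := by
      rw [hjk]; linear_combination (k : ℝ) * hNh
    have hev : χ =ᶠ[nhds y] fun z => (q i).eval (z - k) := by
      filter_upwards [Ioo_mem_nhds hy1' hy2] with z hz
      have h5 := h1.sub_zsmul_eq (x := z) k
      rw [zsmul_one] at h5
      rw [← h5]
      refine hqe i hiN _ ⟨?_, ?_⟩
      · rw [div_eq_mul_inv, ← hdef]; linarith [hz.1]
      · rw [div_eq_mul_inv, ← hdef]; linarith [hz.2]
    have hpoly : ∀ z : ℝ, (q i).eval z = (q i).coeff 0 + (q i).coeff 1 * z := fun z => by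
      rw [Polynomial.eval_eq_sum_range' (n := 2) (by have := hq i hiN; omega)]
      simp [Finset.sum_range_succ]
    have hder : HasDerivAt (fun z : ℝ => (q i).eval (z - k)) ((q i).coeff 1) y := by
      simp only [hpoly]
      simpa using (((hasDerivAt_id y).sub_const (k : ℝ)).const_mul ((q i).coeff 1)).const_add
        ((q i).coeff 0)
    exact hder.congr_of_eventuallyEq hev

/-- Every periodic spline is a combination of B-splines. -/
theorem exists_spl_eq {N : ℕ} (hN : N ≠ 0) (m : ℕ) {χ : ℝ → ℝ} (hχ : χ ∈ splineSpace (m + 2) N) :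
    ∃ c : ℤ → ℝ, Function.Periodic c (N : ℤ) ∧ χ = spl (N : ℝ)⁻¹ (m + 1) c := by
  induction m generalizing χ with
  | zero =>
    obtain ⟨d, hd, hprim⟩ := exists_primitive_step hN hχ
    exact exists_spl_eq_of_primitive hN hd hχ.1 hprim
  | succ m ih =>
    obtain ⟨d, hd, hχd⟩ := ih (deriv_mem_splineSpace hχ)
    refine exists_spl_eq_of_primitive hN hd hχ.1 fun x => ?_
    have h4 : ContDiff ℝ ((m : WithTop ℕ∞) + 1) χ := by exact_mod_cast hχ.2.1
    have h5 := contDiff_succ_iff_deriv.1 h4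
    rw [← hχd, intervalIntegral.integral_deriv_eq_sub fun y _ => h5.1 y]
    · ring
    · exact h5.2.2.continuous.intervalIntegrable _ _

/-! ### Weak derivatives, averages and differences. -/

theorem hasCompactSupport_avg (h : ℝ) {φ : ℝ → ℝ} (hφ : HasCompactSupport φ) :
    HasCompactSupport (avg h φ) := by
  obtain ⟨R, hR0, hR⟩ := hφ.exists_pos_le_norm
  refine HasCompactSupport.intro (isCompact_closedBall (0 : ℝ) (R + |h|)) fun x hx => ?_
  rw [mem_closedBall_zero_iff, Real.norm_eq_abs, not_le] at hx
  have : avg h φ x = ∫ s in (0 : ℝ)..1, (0 : ℝ) := by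
    apply intervalIntegral.integral_congr
    intro s hs
    rw [Set.uIcc_of_le zero_le_one] at hs
    apply hR
    have h1 : |h * s| ≤ |h| := by
      rw [abs_mul, abs_of_nonneg hs.1]
      exact mul_le_of_le_one_right (abs_nonneg _) hs.2
    have h2 := abs_sub_abs_le_abs_sub x (h * s)
    rw [Real.norm_eq_abs]
    linarith
  simpa using this

theorem contDiff_infty_avg {h : ℝ} (hh : h ≠ 0) {φ : ℝ → ℝ} (hφ : ContDiff ℝ (⊤ : ℕ∞) φ) :
    ContDiff ℝ (⊤ : ℕ∞) (avg h φ) := by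
  rw [contDiff_infty] at hφ ⊢
  exact fun n => (contDiff_avg hh (hφ n)).of_le (by exact_mod_cast n.le_succ)

theorem hasCompactSupport_diff (h : ℝ) {φ : ℝ → ℝ} (hφ : HasCompactSupport φ) :
    HasCompactSupport (diff h φ) :=
  hφ.sub (hφ.comp_homeomorph (Homeomorph.subRight h))

theorem continuous_diff (h : ℝ) {φ : ℝ → ℝ} (hφ : Continuous φ) : Continuous (diff h φ) :=
  hφ.sub (hφ.comp (continuous_sub_right h))

theorem integrable_mul_of_hasCompactSupport {f φ : ℝ → ℝ} (hf : LocallyIntegrable f volume)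
    (hφ : Continuous φ) (hφs : HasCompactSupport φ) : Integrable (fun x => f x * φ x) volume := by
  have := hf.integrable_smul_right_of_hasCompactSupport hφ hφs
  simpa using this

/-- Summation by parts. -/
theorem integral_diff_mul (h : ℝ) {f φ : ℝ → ℝ} (hf : LocallyIntegrable f volume)
    (hφ : Continuous φ) (hφs : HasCompactSupport φ) :
    ∫ x, diff h f x * φ x = ∫ x, f x * diff (-h) φ x := by
  have hφ' : Continuous fun x => φ (x + h) := hφ.comp (continuous_add_const h)
  have hφs' : HasCompactSupport fun x => φ (x + h) :=
    hφs.comp_homeomorph (Homeomorph.addRight h)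
  have i1 := integrable_mul_of_hasCompactSupport hf hφ hφs
  have i2 := integrable_mul_of_hasCompactSupport hf hφ' hφs'
  have i3 := integrable_mul_of_hasCompactSupport (locallyIntegrable_comp_add hf (-h)) hφ hφs
  have e1 : ∫ x, f (x + -h) * φ x = ∫ x, f x * φ (x + h) := by
    rw [← integral_add_right_eq_self (fun x => f (x + -h) * φ x) h]
    simp
  simp only [diff, sub_mul, mul_sub, sub_neg_eq_add]
  rw [integral_sub i1 i2, ← e1, ← integral_sub i1 i3]
  simp only [sub_eq_add_neg]

theorem iterate_diff_continuous (h : ℝ) {φ : ℝ → ℝ} (hφ : Continuous φ) (n : ℕ) :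
    Continuous ((diff h)^[n] φ) := by
  induction n with
  | zero => exact hφ
  | succ n ih =>
    rw [Function.iterate_succ_apply']
    exact continuous_diff h ih

theorem hasCompactSupport_iterate_diff (h : ℝ) {φ : ℝ → ℝ} (hφ : HasCompactSupport φ) (n : ℕ) :
    HasCompactSupport ((diff h)^[n] φ) := by
  induction n with
  | zero => exact hφ
  | succ n ih =>
    rw [Function.iterate_succ_apply']
    exact hasCompactSupport_diff h ih

theorem integral_iterate_diff_mul (h : ℝ) {f φ : ℝ → ℝ} (hf : LocallyIntegrable f volume)
    (hφ : Continuous φ) (hφs : HasCompactSupport φ) (n : ℕ) :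
    ∫ x, (diff h)^[n] f x * φ x = ∫ x, f x * (diff (-h))^[n] φ x := by
  induction n generalizing f with
  | zero => rfl
  | succ n ih =>
    rw [Function.iterate_succ_apply, ih (locallyIntegrable_diff hf),
      integral_diff_mul h hf (iterate_diff_continuous _ hφ n)
        (hasCompactSupport_iterate_diff _ hφs n), Function.iterate_succ_apply']

theorem integral_iterate_avg_mul {h : ℝ} (hh : h ≠ 0) {f φ : ℝ → ℝ}
    (hf : LocallyIntegrable f volume) (hφ : Continuous φ) (hφs : HasCompactSupport φ) (n : ℕ) :
    ∫ x, (avg h)^[n] f x * φ x = ∫ x, f x * (avg (-h))^[n] φ x := by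
  induction n generalizing φ with
  | zero => rfl
  | succ n ih =>
    have h1 := integral_mul_avg_of_hasCompactSupport (neg_ne_zero.2 hh)
      (locallyIntegrable_iterate_avg hh hf n) hφ hφs
    rw [neg_neg] at h1
    rw [Function.iterate_succ_apply', ← h1, ih
      (avg_continuous (neg_ne_zero.2 hh) hφ.locallyIntegrable) (hasCompactSupport_avg _ hφs),
      Function.iterate_succ_apply]

theorem iteratedDeriv_iterate_avg {h : ℝ} (hh : h ≠ 0) {φ : ℝ → ℝ} (hφ : Continuous φ) (n : ℕ) :
    iteratedDeriv n ((avg h)^[n] φ) = fun x => h⁻¹ ^ n * (diff h)^[n] φ x := by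
  induction n generalizing φ with
  | zero => simp
  | succ n ih =>
    have h1 := iterate_avg_iterate_diff hh h hφ.locallyIntegrable 1 n
    rw [Function.iterate_one] at h1
    rw [iteratedDeriv_succ, Function.iterate_succ_apply,
      ih (avg_continuous hh hφ.locallyIntegrable), ← h1]
    funext x
    have h2 := (hasDerivAt_avg hh (iterate_diff_continuous h hφ n) x).const_mul (h⁻¹ ^ n)
    rw [h2.deriv, Function.iterate_succ_apply']
    ring

theorem avg_deriv {h : ℝ} (hh : h ≠ 0) {φ : ℝ → ℝ} (hφ : ContDiff ℝ 1 φ) (x : ℝ) :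
    avg h (deriv φ) x = h⁻¹ * diff h φ x := by
  rw [avg_eq hh, diff, intervalIntegral.integral_deriv_eq_sub]
  · exact fun y _ => (hφ.differentiable one_ne_zero) y
  · exact (hφ.continuous_deriv le_rfl).intervalIntegrable _ _

theorem hasCompactSupport_iteratedDeriv {φ : ℝ → ℝ} (hφ : HasCompactSupport φ) (n : ℕ) :
    HasCompactSupport (iteratedDeriv n φ) := by
  induction n with
  | zero => simpa using hφ
  | succ n ih =>
    rw [iteratedDeriv_succ]
    exact ih.deriv

/-- Each step moves the outermost average onto the differentiated test function, where it becomes a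
difference quotient. No continuity of f is needed, so the top derivative of a spline, a step
function, is included. -/
theorem hasWeakDeriv_iterate_avg {h : ℝ} (hh : h ≠ 0) {f : ℝ → ℝ}
    (hf : LocallyIntegrable f volume) (k : ℕ) :
    HasWeakDeriv k ((avg h)^[k] f) (fun x => h⁻¹ ^ k * (diff h)^[k] f x) := by
  refine ⟨locallyIntegrable_iterate_avg hh hf k,
    (locallyIntegrable_iterate_diff hf k).smul (h⁻¹ ^ k), fun φ hφ hφs => ?_⟩
  induction k generalizing f with
  | zero => simp
  | succ k ih =>
    set ψ := iteratedDeriv k φ with hψ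
    have hψc : ContDiff ℝ 1 ψ := by
      rw [contDiff_infty] at hφ
      exact (hφ (1 + k)).iterate_deriv' 1 k |> fun h => by rwa [hψ, iteratedDeriv_eq_iterate]
    have hψs : HasCompactSupport ψ := hasCompactSupport_iteratedDeriv hφs k
    have hF := locallyIntegrable_iterate_avg hh hf k
    have h1 := integral_mul_avg_of_hasCompactSupport (neg_ne_zero.2 hh) hF
      (hψc.continuous_deriv le_rfl) hψs.deriv
    rw [neg_neg] at h1
    have h2 : ∫ x, (avg h)^[k] f x * avg (-h) (deriv ψ) x
        = -h⁻¹ * ∫ x, (avg h)^[k] (diff h f) x * ψ x := by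
      rw [iterate_avg_diff hh h hf, integral_diff_mul h hF hψc.continuous hψs,
        ← integral_const_mul]
      congr 1
      funext x
      rw [avg_deriv (neg_ne_zero.2 hh) hψc, inv_neg]
      ring
    rw [Function.iterate_succ_apply', iteratedDeriv_succ, ← h1, h2,
      ih (locallyIntegrable_diff hf), Function.iterate_succ_apply]
    simp only [mul_assoc, integral_const_mul]
    ring

/-- Uniqueness of weak derivatives lets the final bounds, proved for convenient representatives,
pass to arbitrary ones. -/
theorem _root_.HasWeakDeriv.ae_eq {k : ℕ} {u g g' : ℝ → ℝ} (hg : HasWeakDeriv k u g)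
    (hg' : HasWeakDeriv k u g') : g =ᵐ[volume] g' := by
  refine ae_eq_of_integral_contDiff_smul_eq hg.2.1 hg'.2.1 fun φ hφ hφs => ?_
  have h1 := (hg.2.2 φ hφ hφs).symm.trans (hg'.2.2 φ hφ hφs)
  have h2 := mul_left_cancel₀ (pow_ne_zero k (by norm_num : (-1 : ℝ) ≠ 0)) h1
  simpa only [smul_eq_mul, mul_comm (φ _)] using h2

/-- Test the weak derivative with the l-fold forward mean of φ: its l-th derivative is (-h)^(-l)
times an l-fold forward difference of φ, and both operations move back by adjointness. -/
theorem iterate_diff_ae_eq {h : ℝ} (hh : h ≠ 0) {l : ℕ} {u g : ℝ → ℝ} (hg : HasWeakDeriv l u g) :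
    (diff h)^[l] u =ᵐ[volume] fun x => h ^ l * (avg h)^[l] g x := by
  obtain ⟨hu, hgl, htest⟩ := hg
  refine ae_eq_of_integral_contDiff_smul_eq (locallyIntegrable_iterate_diff hu l)
    ((locallyIntegrable_iterate_avg hh hgl l).smul (h ^ l)) fun φ hφ hφs => ?_
  have hh' : -h ≠ 0 := neg_ne_zero.2 hh
  have hψ : ContDiff ℝ (⊤ : ℕ∞) ((avg (-h))^[l] φ) ∧ HasCompactSupport ((avg (-h))^[l] φ) := by
    clear htest
    induction l with
    | zero => exact ⟨hφ, hφs⟩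
    | succ l ih =>
      rw [Function.iterate_succ_apply']
      exact ⟨contDiff_infty_avg hh' ih.1, hasCompactSupport_avg _ ih.2⟩
  have h1 := htest _ hψ.1 hψ.2
  rw [iteratedDeriv_iterate_avg hh' hφ.continuous,
    ← integral_iterate_avg_mul hh hgl hφ.continuous hφs] at h1
  simp only [mul_left_comm (u _)] at h1
  rw [integral_const_mul, ← integral_iterate_diff_mul h hu hφ.continuous hφs] at h1
  simp only [smul_eq_mul, mul_comm (φ _)]
  simp only [mul_assoc, integral_const_mul]
  rw [inv_pow, neg_pow h, mul_inv, ← inv_pow, inv_neg, inv_one, mul_assoc] at h1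
  have h2 := mul_left_cancel₀ (pow_ne_zero l (by norm_num : (-1 : ℝ) ≠ 0)) h1
  rw [← h2, mul_inv_cancel_left₀ (pow_ne_zero l hh)]

theorem iterate_bdiff_comp_mul (h : ℝ) (F : ℝ → ℝ) (l : ℕ) :
    bdiff^[l] (fun j : ℤ => F (j * h)) = fun j : ℤ => (diff h)^[l] F (j * h) := by
  induction l with
  | zero => rfl
  | succ l ih =>
    funext j
    rw [Function.iterate_succ_apply', ih, Function.iterate_succ_apply', bdiff, diff]
    push_cast
    ring_nf

/-! ### From one period to the real line. -/

theorem locallyIntegrable_of_periodic {f : ℝ → ℝ} (hf : Function.Periodic f 1)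
    (hi : IntegrableOn f (Set.Icc 0 1) volume) : LocallyIntegrable f volume := by
  rw [locallyIntegrable_iff]
  intro K hK
  obtain ⟨a, ha⟩ := hK.bddBelow
  obtain ⟨b, hb⟩ := hK.bddAbove
  have h1 : IntervalIntegrable f volume 0 (0 + 1) := by
    rw [zero_add, intervalIntegrable_iff_integrableOn_Icc_of_le zero_le_one]
    exact hi
  have h2 := hf.intervalIntegrable one_ne_zero h1 a b
  rcases K.eq_empty_or_nonempty with rfl | ⟨x, hx⟩
  · exact integrableOn_empty
  · rw [intervalIntegrable_iff_integrableOn_Icc_of_le ((ha hx).trans (hb hx))] at h2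
    exact h2.mono_set fun y hy => ⟨ha hy, hb hy⟩

/-- The countably many integer translates of the exceptional set are null, and every real number is
an integer translate of its fractional part. -/
theorem ae_of_ae_periodMeasure {p : ℝ → Prop} (hp : ∀ x (n : ℤ), p (x - n) → p x)
    (h : ∀ᵐ x ∂periodMeasure, p x) : ∀ᵐ x, p x := by
  rw [periodMeasure, ae_restrict_iff' measurableSet_Icc] at h
  have h1 : ∀ᵐ x : ℝ, ∀ n : ℤ, x - n ∈ Set.Icc (0 : ℝ) 1 → p (x - n) := by
    rw [ae_all_iff]
    intro n
    exact (measurePreserving_sub_right volume (n : ℝ)).quasiMeasurePreserving.ae h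
  filter_upwards [h1] with x hx
  exact hp x ⌊x⌋ (hx ⌊x⌋ ⟨Int.fract_nonneg x, (Int.fract_lt_one x).le⟩)

theorem eLpNorm_two_periodMeasure {f : ℝ → ℝ} (hf : MemLp f 2 periodMeasure) :
    eLpNorm f 2 periodMeasure = ENNReal.ofReal (√(∫ x in (0 : ℝ)..1, f x ^ 2)) := by
  rw [hf.eLpNorm_eq_integral_rpow_norm two_ne_zero ENNReal.ofNat_ne_top,
    intervalIntegral.integral_of_le zero_le_one, ← integral_Icc_eq_integral_Ioc,
    Real.sqrt_eq_rpow]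
  simp

theorem abs_iterate_avg_le_of_ae' {h M : ℝ} (hh : h ≠ 0) {f : ℝ → ℝ} (hf : ∀ᵐ x, |f x| ≤ M)
    {n : ℕ} (hn : n ≠ 0) (x : ℝ) : |(avg h)^[n] f x| ≤ M := by
  obtain ⟨n, rfl⟩ := Nat.exists_eq_succ_of_ne_zero hn
  rw [Function.iterate_succ_apply]
  exact abs_iterate_avg_le (abs_avg_le_of_ae hh hf) n x

theorem periodic_sample {N : ℕ} (hN : N ≠ 0) {F : ℝ → ℝ} (hF : Function.Periodic F 1) :
    Function.Periodic (fun j : ℤ => F (j * (N : ℝ)⁻¹)) (N : ℤ) := fun j => by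
  have := hF (j * (N : ℝ)⁻¹)
  simp only [← this]
  push_cast
  rw [add_mul, natCast_mul_inv hN]

/-! ### The Gram system for the projection and the final estimates. -/

/-- The normal equations of the projection, in terms of B-spline coefficients. -/
theorem gram_eq_of_isL2Proj {N : ℕ} (hN : N ≠ 0) {m : ℕ} {u : ℝ → ℝ} {c : ℤ → ℝ}
    (hu : LocallyIntegrable u volume) (huP : Function.Periodic u 1)
    (hc : Function.Periodic c (N : ℤ))
    (hproj : IsL2Proj (m + 2) N u (spl (N : ℝ)⁻¹ (m + 1) c)) (j : ℤ) :
    gram (m + 1) c j = (avg (-(N : ℝ)⁻¹))^[m + 2] u (j * (N : ℝ)⁻¹) := by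
  have hh := inv_natCast_pos hN
  have hNh := natCast_mul_inv hN
  have hNpos : (0 : ℤ) < N := by omega
  have key : ∀ i ∈ Finset.range N,
      gram (m + 1) c i = (avg (-(N : ℝ)⁻¹))^[m + 2] u (i * (N : ℝ)⁻¹) := by
    intro i hi
    rw [Finset.mem_range] at hi
    -- Periodic unit sequence: its spline is one periodic B-spline, and testing with it isolates the
    -- i-th equation.
    set e : ℤ → ℝ := fun k => if k % N = i then 1 else 0 with he
    have heP : Function.Periodic e (N : ℤ) := fun k => by simp [he]
    have hsum : ∀ a : ℕ → ℝ, ∑ k ∈ Finset.range N, a k * e k = a i := by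
      intro a
      rw [Finset.sum_eq_single i]
      · simp only [he]
        rw [Int.emod_eq_of_lt (by omega) (by omega)]
        simp
      · intro k hk hki
        rw [Finset.mem_range] at hk
        simp only [he]
        rw [Int.emod_eq_of_lt (by omega) (by omega), if_neg (by exact_mod_cast hki), mul_zero]
      · intro h
        exact absurd (Finset.mem_range.2 hi) h
    have h1 := hproj.2 _ (spl_mem_splineSpace hN heP m)
    have h2 := integral_mul_spl hh hN (by rw [hNh]; exact periodic_spl_one hN hc (m + 1))
      (locallyIntegrable_spl hh (m + 1) c) heP (m + 1)
    have h3 := integral_mul_spl hh hN (by rwa [hNh]) hu heP (m + 1)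
    rw [hNh, hsum] at h2 h3
    rw [h2, h3] at h1
    have h4 := mul_left_cancel₀ hh.ne' h1
    have h5 := iterate_avg_neg_spl hh.ne' (m + 1) c i
    rw [← h5]
    exact_mod_cast h4
  have hper := periodic_sample hN (periodic_iterate_avg (h := -(N : ℝ)⁻¹) huP (m + 2))
  have hsub := (periodic_gram hc (m + 1)).sub hper
  obtain ⟨y, hy, hyj⟩ := hsub.exists_mem_Ico₀ hNpos j
  have hy1 := hy.1
  have hy2 := hy.2
  have h6 := key y.toNat (Finset.mem_range.2 (by omega))
  have h7 : ((y.toNat : ℕ) : ℤ) = y := Int.toNat_of_nonneg hy1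
  have h8 : ((y.toNat : ℕ) : ℝ) = y := by exact_mod_cast h7
  rw [h7, h8] at h6
  simp only [Pi.sub_apply] at hyj
  linarith

/-- The coefficients of the derivative of the projection solve the same Gram system, with samples of
averages of the derivative as data. -/
theorem exists_coeff_deriv_l2Proj {N : ℕ} (hN : N ≠ 0) {m l : ℕ} (hl : l ≤ m + 1) {u g : ℝ → ℝ}
    (huP : Function.Periodic u 1) (hg : HasWeakDeriv l u g) :
    ∃ e : ℤ → ℝ, Function.Periodic e (N : ℤ) ∧
      HasWeakDeriv l (l2Proj (m + 2) N u) (spl (N : ℝ)⁻¹ (m + 1 - l) e) ∧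
      ∀ j : ℤ, gram (m + 1) e j =
        (avg (-(N : ℝ)⁻¹))^[m + 2] ((avg (N : ℝ)⁻¹)^[l] g) (j * (N : ℝ)⁻¹) := by
  have hh := inv_natCast_pos hN
  have hproj := isL2Proj_l2Proj (r := m + 2) (by omega) hN
    (intervalIntegrable_of_locallyIntegrable hg.1 0 1)
  obtain ⟨c, hc, hv⟩ := exists_spl_eq hN m hproj.1
  rw [hv] at hproj ⊢
  have hgram := gram_eq_of_isL2Proj hN hg.1 huP hc hproj
  have hae := iterate_diff_ae_eq hh.ne' hg
  set h := (N : ℝ)⁻¹ with hdef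
  have hh' : -h ≠ 0 := neg_ne_zero.2 hh.ne'
  refine ⟨fun j => h⁻¹ ^ l * bdiff^[l] c j, fun j => ?_, ?_, fun j => ?_⟩
  · simp only [periodic_iterate_bdiff hc l j]
  · have h1 := hasWeakDeriv_iterate_avg hh.ne' (locallyIntegrable_spl hh (m + 1 - l) c) l
    rw [iterate_avg_spl, Nat.add_sub_cancel' hl, iterate_diff_spl hh] at h1
    rw [spl_const_mul]
    exact h1
  · have h2 : gram (m + 1) c = fun j : ℤ => (avg (-h))^[m + 2] u (j * h) := funext hgram
    -- The relation between differences of u and averages of g holds only almost everywhere; the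
    -- first forward mean upgrades it to every point, so it may be sampled at nodes.
    have h3 : (avg (-h))^[m + 2] ((diff h)^[l] u)
        = (avg (-h))^[m + 2] (fun x => h ^ l * (avg h)^[l] g x) := by
      rw [Function.iterate_succ_apply, Function.iterate_succ_apply, avg_congr_ae hh' hae]
      rfl
    rw [gram_const_mul, gram_iterate_bdiff, h2, iterate_bdiff_comp_mul h,
      ← iterate_avg_iterate_diff hh' h hg.1, h3, iterate_avg_const_mul, ← mul_assoc, ← mul_pow,
      inv_mul_cancel₀ hh.ne', one_pow, one_mul]

theorem memLp_spl_periodMeasure {N : ℕ} (hN : N ≠ 0) {e : ℤ → ℝ} (he : Function.Periodic e (N : ℤ))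
    (n : ℕ) (p : ENNReal) : MemLp (spl (N : ℝ)⁻¹ n e) p periodMeasure := by
  obtain ⟨M, hM⟩ := exists_bound_of_periodic hN he
  exact MemLp.of_bound (measurable_spl (inv_natCast_pos hN) n e).aestronglyMeasurable M
    (.of_forall fun x => abs_spl_le hM n x)

/-- The derivatives in question are splines with periodic, hence bounded, coefficients, so they lie
in every L^q whatever p is. -/
theorem memSobolevPer_l2Proj {N : ℕ} (hN : N ≠ 0) {m l : ℕ} (hl : l ≤ m + 1) {p : ENNReal}
    {u : ℝ → ℝ} (hu : MemSobolevPer p l u) (q : ENNReal) :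
    MemSobolevPer q l (l2Proj (m + 2) N u) := by
  obtain ⟨g₀, -, hg₀, -⟩ := hu.2 0 (Nat.zero_le _)
  have hproj := isL2Proj_l2Proj (r := m + 2) (by omega) hN
    (intervalIntegrable_of_locallyIntegrable hg₀.1 0 1)
  refine ⟨hproj.1.1, fun k hk => ?_⟩
  obtain ⟨g, -, hg, -⟩ := hu.2 k hk
  obtain ⟨e, he, hw, -⟩ := exists_coeff_deriv_l2Proj (m := m) hN (hk.trans hl) hu.1 hg
  exact ⟨_, periodic_spl_one hN he _, hw, memLp_spl_periodMeasure hN he _ q⟩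

theorem exists_eLpNorm_two_le (m : ℕ) : ∃ C : NNReal, ∀ (N l : ℕ), N ≠ 0 → l ≤ m + 1 →
    ∀ u : ℝ → ℝ, MemSobolevPer 2 l u → ∀ g w : ℝ → ℝ, HasWeakDeriv l u g →
      HasWeakDeriv l (l2Proj (m + 2) N u) w →
      eLpNorm w 2 periodMeasure ≤ C * eLpNorm g 2 periodMeasure := by
  obtain ⟨κ, hκ0, hκ1, hκ⟩ := exists_gram_coercive (m + 1)
  refine ⟨⟨κ⁻¹, by positivity⟩, fun N l hN hl u hu g' w hg' hw => ?_⟩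
  obtain ⟨g, hgP, hg, hgL⟩ := hu.2 l le_rfl
  obtain ⟨e, he, hwe, hgram⟩ := exists_coeff_deriv_l2Proj (m := m) hN hl hu.1 hg
  have hh := inv_natCast_pos hN
  have hNh := natCast_mul_inv hN
  rw [eLpNorm_congr_ae (ae_restrict_of_ae (hw.ae_eq hwe)),
    eLpNorm_congr_ae (ae_restrict_of_ae (hg'.ae_eq hg)),
    eLpNorm_two_periodMeasure (memLp_spl_periodMeasure hN he _ 2), eLpNorm_two_periodMeasure hgL]
  have hg2 : LocallyIntegrable (fun x => g x ^ 2) volume :=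
    locallyIntegrable_of_periodic (fun x => by simp only [hgP x]) hgL.integrable_sq
  set h := (N : ℝ)⁻¹ with hdef
  have h1 := integral_spl_sq_le hh hN he (m + 1 - l)
  have h2 := sum_sq_le_of_coercive (hκ N hN e he) hκ0.le
  have h3 := sum_sq_iterate_avg_le (f := (avg h)^[l] g) (N := N) hh
    (by rw [hNh]; exact periodic_iterate_avg hgP l)
    (locallyIntegrable_iterate_avg hh.ne' hg.2.1 l)
    (locallyIntegrable_sq_iterate_avg hh.ne' hg.2.1 hg2 l) (n := m + 2) (by omega)
  have h4 := integral_sq_iterate_avg_le zero_le_one hh.ne' hgP hg.2.1 hg2 l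
  rw [hNh] at h1 h3
  have h5 : ∑ j ∈ Finset.range N, gram (m + 1) e j ^ 2
      = ∑ j ∈ Finset.range N, ((avg (-h))^[m + 2] ((avg h)^[l] g) (j * h)) ^ 2 :=
    Finset.sum_congr rfl fun j _ => by rw [hgram]; norm_cast
  rw [← h5] at h3
  -- The chain of contractions: derivative spline to coefficients, coefficients to Gram data by
  -- coercivity, data samples to averages of g, and averages to g. The mesh factor h cancels
  -- throughout.
  have h6 : κ ^ 2 * ∫ x in (0 : ℝ)..1, spl h (m + 1 - l) e x ^ 2
      ≤ ∫ x in (0 : ℝ)..1, g x ^ 2 := by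
    calc κ ^ 2 * ∫ x in (0 : ℝ)..1, spl h (m + 1 - l) e x ^ 2
        ≤ κ ^ 2 * (h * ∑ j ∈ Finset.range N, e j ^ 2) := by gcongr
      _ = h * (κ ^ 2 * ∑ j ∈ Finset.range N, e j ^ 2) := by ring
      _ ≤ h * ∑ j ∈ Finset.range N, gram (m + 1) e j ^ 2 := by gcongr
      _ ≤ _ := h3.trans h4
  have h7 : √(∫ x in (0 : ℝ)..1, spl h (m + 1 - l) e x ^ 2)
      ≤ κ⁻¹ * √(∫ x in (0 : ℝ)..1, g x ^ 2) := by
    rw [le_inv_mul_iff₀ hκ0]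
    calc κ * √(∫ x in (0 : ℝ)..1, spl h (m + 1 - l) e x ^ 2)
        = √(κ ^ 2 * ∫ x in (0 : ℝ)..1, spl h (m + 1 - l) e x ^ 2) := by
          rw [Real.sqrt_mul (sq_nonneg κ), Real.sqrt_sq hκ0.le]
      _ ≤ _ := Real.sqrt_le_sqrt h6
  refine (ENNReal.ofReal_le_ofReal h7).trans_eq ?_
  rw [ENNReal.ofReal_mul (by positivity)]
  congr 1
  exact ENNReal.ofReal_eq_coe_nnreal _

theorem exists_eLpNorm_top_le (m : ℕ) : ∃ C : NNReal, ∀ (N l : ℕ), N ≠ 0 → l ≤ m + 1 →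
    ∀ u : ℝ → ℝ, MemSobolevPer ⊤ l u → ∀ g w : ℝ → ℝ, HasWeakDeriv l u g →
      HasWeakDeriv l (l2Proj (m + 2) N u) w →
      eLpNorm w ⊤ periodMeasure ≤ C * eLpNorm g ⊤ periodMeasure := by
  obtain ⟨C, hC0, hC⟩ := exists_abs_le_of_abs_gram_le (m + 1)
  refine ⟨⟨C, hC0⟩, fun N l hN hl u hu g' w hg' hw => ?_⟩
  obtain ⟨g, hgP, hg, hgL⟩ := hu.2 l le_rfl
  obtain ⟨e, he, hwe, hgram⟩ := exists_coeff_deriv_l2Proj (m := m) hN hl hu.1 hg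
  have hh := inv_natCast_pos hN
  rw [eLpNorm_congr_ae (ae_restrict_of_ae (hw.ae_eq hwe)),
    eLpNorm_congr_ae (ae_restrict_of_ae (hg'.ae_eq hg))]
  set D := (eLpNorm g ⊤ periodMeasure).toReal with hD
  have hDeq : ENNReal.ofReal D = eLpNorm g ⊤ periodMeasure := ENNReal.ofReal_toReal hgL.2.ne
  have hgD : ∀ᵐ x, |g x| ≤ D := by
    refine ae_of_ae_periodMeasure (fun x n hx => ?_) ?_
    · have := hgP.sub_zsmul_eq (x := x) n
      rw [zsmul_one] at this
      rwa [this] at hx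
    · filter_upwards [ae_le_eLpNormEssSup (f := g) (μ := periodMeasure)] with x hx
      rw [← eLpNorm_exponent_top] at hx
      simpa only [toReal_enorm, Real.norm_eq_abs] using ENNReal.toReal_mono hgL.2.ne hx
  obtain ⟨M, hM⟩ := exists_bound_of_periodic hN he
  -- The almost everywhere bound on g becomes pointwise after the forward means, so it controls the
  -- sampled data. M is only qualitative and does not enter the constant.
  have he' := hC e M D hM fun j => by
    rw [hgram]
    exact abs_iterate_avg_le_of_ae' (neg_ne_zero.2 hh.ne')
      (abs_iterate_avg_le_of_ae hh.ne' hgD l) (by omega) _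
  rw [eLpNorm_exponent_top, ← hDeq]
  refine (eLpNormEssSup_le_of_ae_bound (C := C * D)
    (.of_forall fun x => abs_spl_le he' _ x)).trans_eq ?_
  rw [ENNReal.ofReal_mul hC0]
  congr 1
  exact ENNReal.ofReal_eq_coe_nnreal _

end PeriodicSpline

theorem proposition5p1 (r : ℕ) (hr : 2 ≤ r) (l : ℕ) (hl : l ≤ r - 1) :
    ∃ C₁ C₂ : NNReal, ∀ N : ℕ, 4 * r ≤ N →
      (∀ u : ℝ → ℝ, MemSobolevPer 2 l u →
        MemSobolevPer 2 l (l2Proj r N u) ∧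
        ∀ g w : ℝ → ℝ, HasWeakDeriv l u g → HasWeakDeriv l (l2Proj r N u) w →
          eLpNorm w 2 periodMeasure ≤ C₁ * eLpNorm g 2 periodMeasure) ∧
      (∀ u : ℝ → ℝ, MemSobolevPer ⊤ l u → MemSobolevPer 2 l u →
        MemSobolevPer ⊤ l (l2Proj r N u) ∧
        ∀ g w : ℝ → ℝ, HasWeakDeriv l u g → HasWeakDeriv l (l2Proj r N u) w →
          eLpNorm w ⊤ periodMeasure ≤ C₂ * eLpNorm g ⊤ periodMeasure) := by
  obtain ⟨m, rfl⟩ := Nat.exists_eq_add_of_le' hr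
  have hl' : l ≤ m + 1 := by omega
  obtain ⟨C₁, h₁⟩ := PeriodicSpline.exists_eLpNorm_two_le m
  obtain ⟨C₂, h₂⟩ := PeriodicSpline.exists_eLpNorm_top_le m
  refine ⟨C₁, C₂, fun N hN => ?_⟩
  have hN0 : N ≠ 0 := by omega
  exact ⟨fun u hu => ⟨PeriodicSpline.memSobolevPer_l2Proj hN0 hl' hu 2, h₁ N l hN0 hl' u hu⟩,
    fun u hu _ => ⟨PeriodicSpline.memSobolevPer_l2Proj hN0 hl' hu ⊤, h₂ N l hN0 hl' u hu⟩⟩
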